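/- Let $A=(A_{ij})$ be a real symmetric positive-definite $d\times d$ matrix with inverse $A^{-1}=(A^{ij})$, let $m$ be even and $i_1,\dots,i_m\in\{1,\dots,d\}$. *Correlators.* Let $U(x)$ be a polynomial in $x=(x^1,\dots,x^d)$ without linear and quadratic terms. For a polynomial $P$ let $\int e^{-\frac12\langle Ax,x\rangle+\hbar U(x)}P(x)\,dx$ denote the formal power series in $\hbar$ obtained by expanding $e^{\hbar U}$, that is, $$\sum_{n\ge 0}\frac{\hbar^n}{n!}\int_{\mathbb R^d}e^{-\frac12\langle Ax,x\rangle}U(x)^nP(x)\,dx\in\mathbb R[[\hbar]].$$ Put $Z_U=\int e^{-\frac12\langle Ax,x\rangle+\hbar U(x)}dx$ (an invertible series) and $$\langle x^{i_1},\dots,x^{i_m}\rangle_U=\frac1{Z_U}\int e^{-\frac12\langle Ax,x\rangle+\hbar U(x)}x^{i_1}\cdots x^{i_m}\,dx .$$ *Graphs.* Let $\Gamma^m$ be the set of isomorphism classes of finite graphs $\Gamma$ (loops and multiple edges allowed) with $m$ ordered univalent vertices, called legs, all other vertices (the internal ones) being of valence $\ge 3$, such that every connected component of $\Gamma$ has at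 least one leg (no vacuum components). Isomorphisms and automorphisms are bijections of internal vertices and of ends of edges that preserve edges and incidence and fix every leg. Let $|\Gamma|$ be the number of internal vertices and $|\operatorname{Aut}\Gamma|$ the number of automorphisms. A labelling assigns to every end of an edge an index in $\{1,\dots,d\}$ such that the end at the $j$-th leg is labelled $i_j$. For an internal vertex $v$ with labels $a_1,\dots,a_k$ at the adjacent ends put $$U_v=\frac{\partial^kU}{\partial x^{a_1}\cdots\partial x^{a_k}}(0)$$ (so $U_v=U_{a_1\dots a_k}$ if the degree $k$ part of $U$ is written as $\frac1{k!}\sum U_{a_1\dots a_k}x^{a_1}\cdots x^{a_k}$ with symmetric coefficients), and for an edge $e$ with labels $a,b$ at its ends put $A^{-1}_e=A^{ab}$. *Proposition.* In $\mathbb R[[\hbar]]$, $$\langle x^{i_1},\dots,x^{i_m}\rangle_U=\sum_{\Gamma\in\Gamma^m}\frac{\hbar^{|\Gamma|}}{|\operatorname{Aut}\Gamma|}\sum_{\text{labels}}\ \prod_vU_v\prod_eA^{-1}_e ,$$ where for each power of $\hbar$ the sum on the right converges unconditionally. The same holds for any formal power series $U=\sum_NU_N$ ($U_N$ homogeneous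 of degree $N$) without linear and quadratic terms, if its degrees are recorded by a second formal parameter $t$: with $U$ replaced by $U(tx)=\sum_Nt^NU_N(x)$ in the definition of the correlator, one has in $\mathbb R[[\hbar,t]]$ $$\langle x^{i_1},\dots,x^{i_m}\rangle_{U(tx)}=\sum_{\Gamma\in\Gamma^m}\frac{\hbar^{|\Gamma|}\,t^{\operatorname{val}\Gamma}}{|\operatorname{Aut}\Gamma|}\sum_{\text{labels}}\ \prod_vU_v\prod_eA^{-1}_e ,$$ where $\operatorname{val}\Gamma$ is the sum of the valences of the internal vertices. -/

import Mathlib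

open scoped Nat MvPowerSeries.WithPiTopology

noncomputable section

namespace Feynman

/-! ### Gaussian integrals and perturbative correlators -/

/-- The Gaussian integral `∫ exp(-⟨Ax, x⟩ / 2) p(x) dx` over `ℝ^d` of a polynomial `p`
(Lebesgue measure, not normalized). -/
def gaussInt {d : ℕ} (A : Matrix (Fin d) (Fin d) ℝ) (p : MvPolynomial (Fin d) ℝ) : ℝ :=
  ∫ x : Fin d → ℝ, Real.exp (-(1 / 2) * (A.mulVec x ⬝ᵥ x)) * MvPolynomial.eval x p

/-- The Gaussian integral of a formal power series (in formal parameters indexed by `σ`) whose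
coefficients are polynomials in `x`, taken coefficient by coefficient. -/
def gaussSeries {d : ℕ} {σ : Type*} (A : Matrix (Fin d) (Fin d) ℝ)
    (F : MvPowerSeries σ (MvPolynomial (Fin d) ℝ)) : MvPowerSeries σ ℝ :=
  fun e => gaussInt A (MvPowerSeries.coeff e F)

/-- The formal power series `exp V = ∑ V ^ n / n!`, for `V` with zero constant coefficient in the
formal parameters. -/
def expSeries {d : ℕ} {σ : Type*} (V : MvPowerSeries σ (MvPolynomial (Fin d) ℝ)) :
    MvPowerSeries σ (MvPolynomial (Fin d) ℝ) :=
  PowerSeries.subst V (PowerSeries.exp ℝ)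

/-- The formal expansion of `∫ exp(-⟨Ax, x⟩ / 2 + V(x)) p(x) dx`. For `p = 1` this is the
partition function. -/
def perturbedInt {d : ℕ} {σ : Type*} (A : Matrix (Fin d) (Fin d) ℝ)
    (V : MvPowerSeries σ (MvPolynomial (Fin d) ℝ)) (p : MvPolynomial (Fin d) ℝ) :
    MvPowerSeries σ ℝ :=
  gaussSeries A (expSeries V * MvPowerSeries.C p)

/-- The correlator `⟨f_1, …, f_m⟩`: the formal integral of `f_1 ⋯ f_m`, divided by the partition
function. The latter is an invertible power series: its constant coefficient is
`∫ exp(-⟨Ax, x⟩ / 2) dx > 0`. -/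
def correlator {d m : ℕ} {σ : Type*} (A : Matrix (Fin d) (Fin d) ℝ)
    (V : MvPowerSeries σ (MvPolynomial (Fin d) ℝ)) (f : Fin m → MvPolynomial (Fin d) ℝ) :
    MvPowerSeries σ ℝ :=
  perturbedInt A V (∏ j, f j) * (perturbedInt A V 1)⁻¹

/-- `U` has no linear and no quadratic terms. -/
def NoLowTerms {d : ℕ} (U : MvPowerSeries (Fin d) ℝ) : Prop :=
  ∀ e : Fin d →₀ ℕ, e.degree = 1 ∨ e.degree = 2 → MvPowerSeries.coeff e U = 0

/-- The series `ħ U(x)` in the parameter `ħ = X 0`, for a polynomial `U`. -/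
def hbarPotential {d : ℕ} (U : MvPolynomial (Fin d) ℝ) :
    MvPowerSeries (Fin 1) (MvPolynomial (Fin d) ℝ) :=
  MvPowerSeries.X 0 * MvPowerSeries.C U

/-- The series `ħ U(t x) = ħ ∑_N t ^ N U_N(x)` in the parameters `ħ = X 0` and `t = X 1`, for a
formal power series `U` with homogeneous components `U_N`. -/
def hbarScaledPotential {d : ℕ} (U : MvPowerSeries (Fin d) ℝ) :
    MvPowerSeries (Fin 2) (MvPolynomial (Fin d) ℝ) :=
  fun e => if e 0 = 1 then
      MvPolynomial.homogeneousComponent (e 1) (MvPowerSeries.truncTotal (e 1 + 1) U)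
    else 0

/-! ### Graphs with ordered legs -/

/-- A finite graph (loops and multiple edges allowed) with `m` ordered univalent vertices, the
legs, and with internal vertices of valence at least `3`. An edge `e` has the two ends
`(e, false)` and `(e, true)`, and `attach` gives the vertex at which an end of an edge is
attached: either a leg, `Sum.inl j`, or an internal vertex, `Sum.inr v`. -/
structure Graph (m : ℕ) where
  /-- the number of internal vertices -/
  numInt : ℕ
  /-- the number of edges -/
  numEdges : ℕ
  /-- the vertex at an end of an edge -/
  attach : Fin numEdges × Bool → Fin m ⊕ Fin numInt
  leg_univalent : ∀ j : Fin m, ∃! h, attach h = Sum.inl j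
  three_le_valence : ∀ v : Fin numInt,
    3 ≤ (Finset.univ.filter fun h => attach h = Sum.inr v).card

namespace Graph

/-- The star of an internal vertex: the ends of edges attached to it. -/
def star {m : ℕ} (G : Graph m) (v : Fin G.numInt) : Finset (Fin G.numEdges × Bool) :=
  Finset.univ.filter fun h => G.attach h = Sum.inr v

/-- The sum of the valences of the internal vertices. -/
def totalValence {m : ℕ} (G : Graph m) : ℕ := ∑ v, (G.star v).card

/-- The simple graph that underlies `G`; it is used for connected components. -/
def toSimple {m : ℕ} (G : Graph m) : SimpleGraph (Fin m ⊕ Fin G.numInt) :=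
  SimpleGraph.fromRel fun v w => ∃ e, G.attach (e, false) = v ∧ G.attach (e, true) = w

/-- Every connected component of `G` has at least one leg. -/
def NonVacuum {m : ℕ} (G : Graph m) : Prop :=
  ∀ c : G.toSimple.ConnectedComponent, ∃ j : Fin m,
    G.toSimple.connectedComponentMk (Sum.inl j) = c

/-- Isomorphisms: bijections between the internal vertices and between the ends of edges that map
edges to edges, preserve the incidence relation, and fix every leg. -/
structure Iso {m : ℕ} (G H : Graph m) where
  /-- the bijection of internal vertices -/
  vert : Fin G.numInt ≃ Fin H.numInt
  /-- the bijection of ends of edges -/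
  half : Fin G.numEdges × Bool ≃ Fin H.numEdges × Bool
  half_flip : ∀ e b, half (e, !b) = ((half (e, b)).1, !(half (e, b)).2)
  attach_half : ∀ h, H.attach (half h) = Sum.map id vert (G.attach h)

/-- The number `|Aut G|` of automorphisms of `G`. -/
def autCard {m : ℕ} (G : Graph m) : ℕ := Nat.card (Iso G G)

/-- Isomorphism of graphs, as an equivalence relation on the non-vacuum graphs. -/
instance isoSetoid (m : ℕ) : Setoid {G : Graph m // G.NonVacuum} where
  r G H := Nonempty (Iso G.1 H.1)
  iseqv := by
    refine ⟨fun G => ⟨⟨Equiv.refl _, Equiv.refl _, ?_, ?_⟩⟩, ?_, ?_⟩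
    · intro e b; rfl
    · intro h
      rw [Equiv.refl_apply]
      rcases G.1.attach h with j | v <;> rfl
    · rintro G H ⟨f⟩
      refine ⟨⟨f.vert.symm, f.half.symm, ?_, ?_⟩⟩
      · intro e b
        rw [Equiv.symm_apply_eq, f.half_flip]
        simp
      · intro h
        have h1 := f.attach_half (f.half.symm h)
        rw [Equiv.apply_symm_apply] at h1
        rw [h1]
        rcases G.1.attach (f.half.symm h) with j | v <;> simp
    · rintro G H K ⟨f⟩ ⟨g⟩
      refine ⟨⟨f.vert.trans g.vert, f.half.trans g.half, ?_, ?_⟩⟩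
      · intro e b
        simp only [Equiv.trans_apply]
        rw [f.half_flip, g.half_flip]
      · intro h
        simp only [Equiv.trans_apply]
        rw [g.attach_half, f.attach_half]
        rcases G.1.attach h with j | v <;> simp

/-- The set `Γ^m` of isomorphism classes of non-vacuum graphs with `m` ordered legs. -/
def NonVacuumClass (m : ℕ) : Type := Quotient (isoSetoid m)

/-- A graph that represents an isomorphism class. -/
def NonVacuumClass.rep {m : ℕ} (c : NonVacuumClass m) : Graph m := (Quotient.out c).1

end Graph

/-! ### Feynman rules -/

/-- The factor `U_{i_1 … i_k} = ∂_{i_1} ⋯ ∂_{i_k} U (0)` of an internal vertex with the labels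
`s = {i_1, …, i_k}`. The symmetric tensors so defined satisfy
`U(x) = ∑_k (1 / k!) ∑_{i_1, …, i_k} U_{i_1 … i_k} x^{i_1} ⋯ x^{i_k}`. -/
def vertexFactor {d : ℕ} (U : MvPowerSeries (Fin d) ℝ) (s : Multiset (Fin d)) : ℝ :=
  (∏ i, ((s.count i)! : ℝ)) * MvPowerSeries.coeff (Multiset.toFinsupp s) U

/-- The sum `∑_labels ∏_v U_v ∏_e A⁻¹_e`, over all labellings of the ends of edges by indices
`1, …, d` for which the end at the `j`-th leg has the label `i j`. -/
def labelSum {d m : ℕ} (A : Matrix (Fin d) (Fin d) ℝ) (U : MvPowerSeries (Fin d) ℝ)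
    (i : Fin m → Fin d) (G : Graph m) : ℝ :=
  open Classical in
  ∑ l ∈ (Finset.univ.filter fun l : Fin G.numEdges × Bool → Fin d =>
      ∀ h j, G.attach h = Sum.inl j → l h = i j),
    (∏ v, vertexFactor U ((G.star v).val.map l)) * ∏ e, A⁻¹ (l (e, false)) (l (e, true))

end Feynman

end

noncomputable section

namespace Feynman

/-! Integration by parts reduces the Gaussian integral of `X i * p` to those of the derivatives of
`p`. By induction on the degree, the integral of `p` is therefore `gaussInt A 1` times the value at
`0` of `exp (Δ / 2) p`, where `Δ = ∑ A⁻¹ a b ∂_a ∂_b` (`hasSum_gaussInt`).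

For a product of `m` linear factors and `n` copies of `U`, the Leibniz rule expands `Δ ^ E` at `0`
into a sum over labels of the `2E` ends of edges and over all attaching maps `Fin E × Bool → Fin m ⊕
Fin n` (`constantCoeff_laplace_pow_prod`). With the `1 / n!` of `exp U` and the `1 / (E! 2 ^ E)` of
`exp (Δ / 2)`, each map carries the factor `1 / (n! E! 2 ^ E)`.

Every attaching map is in a unique way the disjoint union of the part joined to the legs and a part
without legs. Since the number of ways to distribute vertices and edges is a product of binomials,
the normalized sums factor (`sum_graphWeight_eq`). The second factor is the partition function, so
division by it leaves the sum over maps without vacuum components.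

The group of order `n! E! 2 ^ E` that permutes vertices and edges and reverses edges acts on these
maps. Its orbits are isomorphism classes and its stabilizers are automorphism groups, so
orbit-stabilizer turns the normalization into `1 / |Aut|` (`card_toClass_mul_autCard`).

Each coefficient involves finitely many graphs: for polynomial `U` the degree bounds the number of
edges (`labelSum_eq_zero_of_lt`), and in the scaled case the exponent of `t` determines it
(`Graph.totalValence_add`). -/

open MvPolynomial in
/-- The polynomial `⟨Ax, x⟩`. -/
def quadPoly {d : ℕ} (A : Matrix (Fin d) (Fin d) ℝ) : MvPolynomial (Fin d) ℝ :=
  ∑ i, ∑ j, C (A i j) * X j * X i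

/-! ### Gaussian integrals of polynomials and integration by parts -/

section Gauss

variable {d : ℕ} {A : Matrix (Fin d) (Fin d) ℝ}

open MvPolynomial MeasureTheory

lemma eval_quadPoly (x : Fin d → ℝ) : eval x (quadPoly A) = A.mulVec x ⬝ᵥ x := by
  simp [quadPoly, dotProduct, Matrix.mulVec, Finset.sum_mul]

lemma pderiv_quadPoly (hA : A.IsSymm) (b : Fin d) :
    pderiv b (quadPoly A) = 2 * ∑ j, C (A b j) * X j := by
  have h1 : ∀ i j : Fin d, pderiv b (C (A i j) * X j * X i : MvPolynomial (Fin d) ℝ) =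
      (if i = b then C (A i j) * X j else 0) + (if j = b then C (A i j) * X i else 0) := by
    intro i j
    rw [pderiv_mul, pderiv_C_mul, pderiv_X, pderiv_X]
    simp only [Pi.single_apply]
    split_ifs <;> simp [add_comm]
  simp only [quadPoly, map_sum, h1, Finset.sum_add_distrib]
  rw [Finset.sum_comm (f := fun i j => if j = b then C (A i j) * X i else (0 : MvPolynomial (Fin d) ℝ)),
    Finset.sum_comm (f := fun i j => if i = b then C (A i j) * X j else (0 : MvPolynomial (Fin d) ℝ))]
  simp only [Finset.sum_ite_eq', Finset.mem_univ, if_true]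
  rw [Finset.sum_comm]
  simp only [Finset.sum_ite_eq', Finset.mem_univ, if_true]
  rw [two_mul]
  congr 1
  exact Finset.sum_congr rfl fun j _ => by rw [hA.apply b j]

/-- Links the formal `pderiv` to the analytic directional derivative that integration by parts
requires. -/
lemma hasDerivAt_eval_line (p : MvPolynomial (Fin d) ℝ) (x : Fin d → ℝ) (b : Fin d) (t : ℝ) :
    HasDerivAt (fun t : ℝ => eval (x + t • Pi.single b (1 : ℝ)) p)
      (eval (x + t • Pi.single b (1 : ℝ)) (pderiv b p)) t := by
  induction p using MvPolynomial.induction_on with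
  | C a => simpa using hasDerivAt_const t a
  | add p q hp hq => simp only [map_add]; exact hp.add hq
  | mul_X p i hp =>
    have h1 : HasDerivAt (fun t : ℝ => x i + t * (Pi.single b (1 : ℝ) : Fin d → ℝ) i)
        ((Pi.single b (1 : ℝ) : Fin d → ℝ) i) t := by
      simpa using ((hasDerivAt_id t).mul_const _).const_add (x i)
    have h2 : eval (x + t • Pi.single b (1 : ℝ)) (pderiv b (X i : MvPolynomial (Fin d) ℝ)) =
        (Pi.single b (1 : ℝ) : Fin d → ℝ) i := by
      rw [pderiv_X]
      by_cases h : b = i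
      · subst h; simp
      · simp [h, eq_comm (a := i)]
    have h3 := hp.mul h1
    simp only [pderiv_mul, map_add, map_mul, h2, eval_X, Pi.add_apply, Pi.smul_apply, smul_eq_mul]
    exact h3

/-- The form attains a positive minimum on the compact unit sphere, and scaling does the rest. A sum
of squares is used as lower bound because its Gaussian is a product of one-variable functions. -/
lemma exists_pos_mul_sum_sq_le (hA : A.PosDef) :
    ∃ c : ℝ, 0 < c ∧ ∀ x : Fin d → ℝ, c * ∑ i, x i ^ 2 ≤ A.mulVec x ⬝ᵥ x := by
  have hcont : Continuous fun x : Fin d → ℝ => A.mulVec x ⬝ᵥ x := by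
    simp_rw [← eval_quadPoly]
    exact MvPolynomial.continuous_eval _
  have hpos : ∀ x : Fin d → ℝ, x ≠ 0 → 0 < A.mulVec x ⬝ᵥ x := by
    intro x hx
    have := hA.dotProduct_mulVec_pos hx
    rwa [star_trivial, dotProduct_comm] at this
  obtain ⟨c, hc, hle⟩ := (isCompact_sphere (0 : Fin d → ℝ) 1).exists_forall_le'
    hcont.continuousOn (a := 0) fun x hx => hpos x fun h => by simp [h] at hx
  -- The sphere is that of the sup norm, for which `∑ x i ^ 2 ≤ d * ‖x‖ ^ 2`; using `d + 1` keeps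
  -- the denominator nonzero when `d = 0`.
  refine ⟨c / (d + 1), by positivity, fun x => ?_⟩
  by_cases hx : x = 0
  · simp [hx]
  have hn : 0 < ‖x‖ := norm_pos_iff.2 hx
  have h1 := hle (‖x‖⁻¹ • x) (by simp [norm_smul, hn.ne'])
  rw [Matrix.mulVec_smul, smul_dotProduct, dotProduct_smul, smul_eq_mul, smul_eq_mul,
    ← mul_assoc, ← mul_inv, inv_mul_eq_div, le_div_iff₀ (by positivity)] at h1
  have h2 : ∑ i, x i ^ 2 ≤ (d + 1) * (‖x‖ * ‖x‖) := by
    calc ∑ i, x i ^ 2 ≤ ∑ _i : Fin d, ‖x‖ * ‖x‖ := Finset.sum_le_sum fun i _ => by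
          rw [← sq_abs, sq]
          have := norm_le_pi_norm x i
          rw [Real.norm_eq_abs] at this
          gcongr
      _ = d * (‖x‖ * ‖x‖) := by simp
      _ ≤ _ := by gcongr; linarith
  calc c / (d + 1) * ∑ i, x i ^ 2 ≤ c / (d + 1) * ((d + 1) * (‖x‖ * ‖x‖)) := by gcongr
    _ = c * (‖x‖ * ‖x‖) := by field_simp
    _ ≤ _ := h1

/-- A monomial times the Gaussian is dominated by a product of one-variable functions `y ^ k * exp
(-c y ^ 2 / 2)`. -/
lemma integrable_gauss_mul_eval (hA : A.PosDef) (p : MvPolynomial (Fin d) ℝ) :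
    Integrable fun x : Fin d → ℝ => Real.exp (-(1 / 2) * (A.mulVec x ⬝ᵥ x)) * eval x p := by
  induction p using MvPolynomial.induction_on' with
  | add p q hp hq => simp only [map_add, mul_add]; exact hp.add hq
  | monomial e r =>
    obtain ⟨c, hc, hle⟩ := exists_pos_mul_sum_sq_le hA
    have h1 : Integrable fun x : Fin d → ℝ => ∏ i, (x i ^ e i * Real.exp (-(c / 2) * x i ^ 2)) := by
      refine Integrable.fintype_prod (f := fun i (y : ℝ) => y ^ e i * Real.exp (-(c / 2) * y ^ 2))
        fun i => ?_
      have := integrable_rpow_mul_exp_neg_mul_sq (b := c / 2) (by positivity) (s := e i)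
        (by have : (0 : ℝ) ≤ e i := by positivity
            linarith)
      simpa only [Real.rpow_natCast] using this
    refine (h1.norm.const_mul ‖r‖).mono' ?_ (.of_forall fun x => ?_)
    · apply Continuous.aestronglyMeasurable
      simp_rw [← eval_quadPoly]
      have h3 := MvPolynomial.continuous_eval (quadPoly A)
      have h4 := MvPolynomial.continuous_eval (monomial e r)
      fun_prop
    · rw [eval_monomial, Finsupp.prod_fintype _ _ (by simp), Finset.prod_mul_distrib,
        ← Real.exp_sum, norm_mul, norm_mul, norm_mul, Real.norm_of_nonneg (Real.exp_pos _).le,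
        Real.norm_of_nonneg (Real.exp_pos _).le, ← Finset.mul_sum]
      have h2 : Real.exp (-(1 / 2) * (A.mulVec x ⬝ᵥ x)) ≤
          Real.exp (-(c / 2) * ∑ i, x i ^ 2) := by
        apply Real.exp_le_exp.2
        have := hle x
        linarith
      calc _ ≤ Real.exp (-(c / 2) * ∑ i, x i ^ 2) * (‖r‖ * ‖∏ i, x i ^ e i‖) := by gcongr
        _ = _ := by ring

lemma gaussInt_add (hA : A.PosDef) (p q : MvPolynomial (Fin d) ℝ) :
    gaussInt A (p + q) = gaussInt A p + gaussInt A q := by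
  simp only [gaussInt, map_add, mul_add]
  exact integral_add (integrable_gauss_mul_eval hA p) (integrable_gauss_mul_eval hA q)

lemma gaussInt_smul (r : ℝ) (p : MvPolynomial (Fin d) ℝ) :
    gaussInt A (r • p) = r * gaussInt A p := by
  simp only [gaussInt, smul_eval, ← integral_const_mul]
  congr 1; ext x; ring

/-- The Gaussian integral as a linear functional. -/
def gaussLin (hA : A.PosDef) : MvPolynomial (Fin d) ℝ →ₗ[ℝ] ℝ where
  toFun := gaussInt A
  map_add' := gaussInt_add hA
  map_smul' := gaussInt_smul

lemma gaussInt_one_pos (hA : A.PosDef) : 0 < gaussInt A 1 := by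
  have := integrable_gauss_mul_eval hA 1
  simp only [map_one, mul_one] at this
  simpa [gaussInt] using integral_exp_pos this

/-- The derivative is moved onto the Gaussian, which brings down the linear form `∑ A b j x_j`. All
integrands involved are Gaussian times polynomial, hence integrable. -/
lemma gaussInt_pderiv (hA : A.PosDef) (b : Fin d) (p : MvPolynomial (Fin d) ℝ) :
    gaussInt A (pderiv b p) = ∑ j, A b j * gaussInt A (X j * p) := by
  have hsymm : A.IsSymm := by simpa using hA.isHermitian
  have key := integral_bilinear_hasLineDerivAt_right_eq_neg_left_of_integrable
    (μ := (volume : Measure (Fin d → ℝ)))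
    (B := ContinuousLinearMap.mul ℝ ℝ) (v := Pi.single b (1 : ℝ))
    (f := fun x : Fin d → ℝ => Real.exp (-(1 / 2) * (A.mulVec x ⬝ᵥ x)))
    (f' := fun x => Real.exp (-(1 / 2) * (A.mulVec x ⬝ᵥ x)) *
      (-(1 / 2) * eval x (pderiv b (quadPoly A))))
    (g := fun x => eval x p) (g' := fun x => eval x (pderiv b p))
  simp only [ContinuousLinearMap.mul_apply'] at key
  have h1 : ∀ x : Fin d → ℝ, Real.exp (-(1 / 2) * (A.mulVec x ⬝ᵥ x)) *
      (-(1 / 2) * eval x (pderiv b (quadPoly A))) * eval x p =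
      Real.exp (-(1 / 2) * (A.mulVec x ⬝ᵥ x)) *
        eval x (-((∑ j, C (A b j) * X j) * p)) := by
    intro x
    rw [pderiv_quadPoly hsymm]
    simp only [map_mul, map_neg, map_ofNat]
    ring
  simp only [h1] at key
  have key2 := key (integrable_gauss_mul_eval hA _) (integrable_gauss_mul_eval hA _)
    (integrable_gauss_mul_eval hA _) ?_ ?_
  · rw [gaussInt, key2]
    have h2 : -(-((∑ j, C (A b j) * X j) * p)) = ∑ j, A b j • (X j * p) := by
      rw [neg_neg, Finset.sum_mul]
      exact Finset.sum_congr rfl fun j _ => by rw [smul_eq_C_mul, mul_assoc]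
    change -(gaussLin hA _) = _
    rw [← map_neg, h2, map_sum]
    exact Finset.sum_congr rfl fun j _ => gaussInt_smul _ _
  · intro x _
    have := (((hasDerivAt_eval_line (quadPoly A) x b 0).const_mul (-(1 / 2))).exp)
    simp only [eval_quadPoly] at this
    simpa [HasLineDerivAt] using this
  · intro x _
    simpa [HasLineDerivAt] using hasDerivAt_eval_line p x b 0

/-- Gaussian integration by parts. -/
lemma gaussInt_X_mul (hA : A.PosDef) (i : Fin d) (p : MvPolynomial (Fin d) ℝ) :
    gaussInt A (X i * p) = ∑ b, A⁻¹ i b * gaussInt A (pderiv b p) := by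
  have hu : A⁻¹ * A = 1 := Matrix.nonsing_inv_mul _ (hA.det_pos.ne'.isUnit)
  simp_rw [gaussInt_pderiv hA, Finset.mul_sum]
  rw [Finset.sum_comm]
  have h : ∀ j, ∑ b, A⁻¹ i b * (A b j * gaussInt A (X j * p)) =
      (1 : Matrix (Fin d) (Fin d) ℝ) i j * gaussInt A (X j * p) := by
    intro j
    rw [← hu, Matrix.mul_apply, Finset.sum_mul]
    exact Finset.sum_congr rfl fun b _ => (mul_assoc _ _ _).symm
  simp [h, Matrix.one_apply]

end Gauss

/-! ### Wick's theorem in operator form -/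

section Wick

variable {d : ℕ}

open MvPolynomial

/-- The operator `∑ g a b ∂_a ∂_b`. -/
def laplace (g : Matrix (Fin d) (Fin d) ℝ) : MvPolynomial (Fin d) ℝ →ₗ[ℝ] MvPolynomial (Fin d) ℝ :=
  ∑ a, ∑ b, g a b • ((pderiv a).toLinearMap ∘ₗ (pderiv b).toLinearMap)

lemma laplace_apply (g : Matrix (Fin d) (Fin d) ℝ) (p : MvPolynomial (Fin d) ℝ) :
    laplace g p = ∑ a, ∑ b, g a b • pderiv a (pderiv b p) := by
  simp [laplace]

lemma pderiv_comm (a b : Fin d) (p : MvPolynomial (Fin d) ℝ) :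
    pderiv a (pderiv b p) = pderiv b (pderiv a p) := by
  ext s
  simp only [coeff_pderiv]
  by_cases h : a = b
  · subst h; rfl
  · rw [add_right_comm]
    simp [h, Ne.symm h]
    ring

lemma laplace_pderiv (g : Matrix (Fin d) (Fin d) ℝ) (b : Fin d) (p : MvPolynomial (Fin d) ℝ) :
    laplace g (pderiv b p) = pderiv b (laplace g p) := by
  simp only [laplace_apply, map_sum, Derivation.map_smul]
  refine Finset.sum_congr rfl fun a _ => Finset.sum_congr rfl fun c _ => ?_
  rw [pderiv_comm c b, pderiv_comm a b]

/-- This is the commutator of the operator with multiplication by `X i`; symmetry of `g` makes the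
two cross terms equal. -/
lemma laplace_X_mul {g : Matrix (Fin d) (Fin d) ℝ} (hg : g.IsSymm) (i : Fin d)
    (p : MvPolynomial (Fin d) ℝ) :
    laplace g (X i * p) = X i * laplace g p + (2 : ℝ) • ∑ b, g i b • pderiv b p := by
  have h1 : ∀ a b, g a b • pderiv a (pderiv b (X i * p)) = X i * (g a b • pderiv a (pderiv b p)) +
      ((if a = i then g a b • pderiv b p else 0) + (if b = i then g a b • pderiv a p else 0)) := by
    intro a b
    rw [pderiv_mul, map_add, pderiv_mul, pderiv_mul]
    have h2 : ∀ c e : Fin d, pderiv c (pderiv e (X i : MvPolynomial (Fin d) ℝ)) = 0 := by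
      intro c e
      rw [pderiv_X]
      by_cases h : e = i
      · subst h; simp
      · simp [h]
    rw [h2, pderiv_X, pderiv_X]
    simp only [Pi.single_apply, eq_comm (a := i), mul_smul_comm]
    split_ifs <;> simp <;> ring
  simp only [laplace_apply, h1, Finset.sum_add_distrib, ← Finset.mul_sum]
  congr 1
  rw [Finset.sum_comm (f := fun a b => if a = i then g a b • pderiv b p else 0)]
  simp only [Finset.sum_ite_eq', Finset.mem_univ, if_true]
  rw [two_smul]
  congr 1
  exact Finset.sum_congr rfl fun b _ => by rw [hg.apply i b]

/-- The commutator of `laplace g` with `X i` has constant coefficients, so it commutes with `laplace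
g` and each of the `E + 1` factors contributes equally. -/
lemma laplace_pow_succ_X_mul {g : Matrix (Fin d) (Fin d) ℝ} (hg : g.IsSymm) (i : Fin d)
    (E : ℕ) (p : MvPolynomial (Fin d) ℝ) :
    (laplace g ^ (E + 1)) (X i * p) = X i * (laplace g ^ (E + 1)) p +
      (2 * (E + 1) : ℝ) • ∑ b, g i b • (laplace g ^ E) (pderiv b p) := by
  induction E with
  | zero => simp [laplace_X_mul hg]
  | succ E ih =>
    have hc : ∀ b, laplace g ((laplace g ^ E) (pderiv b p)) = (laplace g ^ (E + 1)) (pderiv b p) :=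
      fun b => by rw [pow_succ']; rfl
    have hc' : ∀ b, pderiv b ((laplace g ^ (E + 1)) p) = (laplace g ^ (E + 1)) (pderiv b p) := by
      intro b
      induction E + 1 with
      | zero => rfl
      | succ k ihk => rw [pow_succ', Module.End.mul_apply, Module.End.mul_apply, ← ihk, laplace_pderiv]
    rw [pow_succ', Module.End.mul_apply, ih, map_add, laplace_X_mul hg, map_smul, map_sum,
      Module.End.mul_apply, add_assoc]
    simp only [map_smul, hc, hc']
    rw [← add_smul]
    push_cast
    ring_nf

/-- Wick's theorem: Gaussian integrals of polynomials are computed by the operator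
`exp (∑ A⁻¹ a b ∂_a ∂_b / 2)` followed by evaluation at `0`. -/
lemma hasSum_gaussInt {A : Matrix (Fin d) (Fin d) ℝ} (hA : A.PosDef)
    (p : MvPolynomial (Fin d) ℝ) :
    HasSum (fun E : ℕ => gaussInt A 1 * (((E ! : ℝ) * 2 ^ E)⁻¹ *
      constantCoeff ((laplace A⁻¹ ^ E) p))) (gaussInt A p) := by
  have hg : (A⁻¹).IsSymm := by simpa using hA.isHermitian.inv
  have hadd : ∀ p q : MvPolynomial (Fin d) ℝ,
      HasSum (fun E : ℕ => gaussInt A 1 * (((E ! : ℝ) * 2 ^ E)⁻¹ *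
        constantCoeff ((laplace A⁻¹ ^ E) p))) (gaussInt A p) →
      HasSum (fun E : ℕ => gaussInt A 1 * (((E ! : ℝ) * 2 ^ E)⁻¹ *
        constantCoeff ((laplace A⁻¹ ^ E) q))) (gaussInt A q) →
      HasSum (fun E : ℕ => gaussInt A 1 * (((E ! : ℝ) * 2 ^ E)⁻¹ *
        constantCoeff ((laplace A⁻¹ ^ E) (p + q)))) (gaussInt A (p + q)) := by
    intro p q hp hq
    rw [gaussInt_add hA]
    convert! hp.add hq using 2 with E
    simp only [map_add]
    ring
  have hsmul : ∀ (r : ℝ) (p : MvPolynomial (Fin d) ℝ),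
      HasSum (fun E : ℕ => gaussInt A 1 * (((E ! : ℝ) * 2 ^ E)⁻¹ *
        constantCoeff ((laplace A⁻¹ ^ E) p))) (gaussInt A p) →
      HasSum (fun E : ℕ => gaussInt A 1 * (((E ! : ℝ) * 2 ^ E)⁻¹ *
        constantCoeff ((laplace A⁻¹ ^ E) (r • p)))) (gaussInt A (r • p)) := by
    intro r p hp
    rw [gaussInt_smul]
    convert! hp.mul_left r using 2 with E
    simp only [map_smul, constantCoeff_smul, smul_eq_mul]
    ring
  have hmon : ∀ (N : ℕ) (s : Fin d →₀ ℕ), s.degree = N → ∀ r : ℝ,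
      HasSum (fun E : ℕ => gaussInt A 1 * (((E ! : ℝ) * 2 ^ E)⁻¹ *
        constantCoeff ((laplace A⁻¹ ^ E) (monomial s r)))) (gaussInt A (monomial s r)) := by
    intro N
    induction N using Nat.strong_induction_on with
    | _ N ih =>
      intro s hs r
      by_cases h0 : s = 0
      · subst h0
        have : (monomial 0 r : MvPolynomial (Fin d) ℝ) = r • 1 := by
          rw [smul_eq_C_mul, mul_one]; rfl
        rw [this]
        apply hsmul
        have h1 := hasSum_single (f := fun E : ℕ => gaussInt A 1 * (((E ! : ℝ) * 2 ^ E)⁻¹ *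
          constantCoeff ((laplace A⁻¹ ^ E) 1))) 0 (by
            intro E hE
            obtain ⟨k, rfl⟩ := Nat.exists_eq_succ_of_ne_zero hE
            rw [Nat.succ_eq_add_one, pow_succ (laplace A⁻¹), Module.End.mul_apply]
            have : laplace A⁻¹ (1 : MvPolynomial (Fin d) ℝ) = 0 := by simp [laplace_apply]
            simp [this])
        simpa using h1
      · obtain ⟨i, hi⟩ := Finsupp.ne_iff.1 h0
        have hi1 : 1 ≤ s i := Nat.one_le_iff_ne_zero.2 hi
        set s' := s - Finsupp.single i 1
        have hss : s' + Finsupp.single i 1 = s :=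
          tsub_add_cancel_of_le (Finsupp.single_le_iff.2 hi1)
        have hdeg : s'.degree + 1 = N := by rw [← hs, ← hss]; simp
        have hmul : (monomial s r : MvPolynomial (Fin d) ℝ) = X i * monomial s' r := by
          rw [← hss, X, monomial_mul, one_mul, add_comm]
        rw [hmul, gaussInt_X_mul hA]
        have hb : ∀ b, HasSum (fun E : ℕ => gaussInt A 1 * (((E ! : ℝ) * 2 ^ E)⁻¹ *
            constantCoeff ((laplace A⁻¹ ^ E) (pderiv b (monomial s' r)))))
            (gaussInt A (pderiv b (monomial s' r))) := by
          intro b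
          rw [pderiv_monomial]
          refine ih (s' - Finsupp.single b 1).degree ?_ _ rfl _
          have := Finsupp.degree_mono (R := ℕ) (tsub_le_self : s' - Finsupp.single b 1 ≤ s')
          omega
        -- The term `E = 0` vanishes since `X i * p` has no constant term. After the shift, the `2
        -- (E + 1)` of the commutator turns `1 / ((E + 1)! 2 ^ (E + 1))` into `1 / (E! 2 ^ E)`,
        -- which matches integration by parts.
        rw [← hasSum_nat_add_iff' 1]
        have h2 := hasSum_sum (s := Finset.univ) fun b _ => (hb b).mul_left (A⁻¹ i b)
        convert! h2 using 1
        · ext E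
          rw [laplace_pow_succ_X_mul hg]
          simp only [map_add, map_mul, constantCoeff_X, zero_mul, zero_add, constantCoeff_smul,
            map_sum, smul_eq_mul, Finset.mul_sum]
          refine Finset.sum_congr rfl fun b _ => ?_
          rw [Nat.factorial_succ]
          push_cast
          field_simp
          ring
        · simp
  induction p using MvPolynomial.induction_on' with
  | monomial s r => exact hmon _ s rfl r
  | add p q hp hq => exact hadd p q hp hq

end Wick

/-! ### The Leibniz rule and the expansion into attaching maps -/

section VertexFactor

variable {d : ℕ}

lemma vertexFactor_zero (U : MvPowerSeries (Fin d) ℝ) :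
    vertexFactor U 0 = MvPowerSeries.constantCoeff U := by
  simp [vertexFactor]

lemma vertexFactor_smul (r : ℝ) (P : MvPowerSeries (Fin d) ℝ) (s : Multiset (Fin d)) :
    vertexFactor (r • P) s = r * vertexFactor P s := by
  simp [vertexFactor]
  ring

lemma vertexFactor_sum {ι : Type*} (T : Finset ι) (P : ι → MvPowerSeries (Fin d) ℝ)
    (s : Multiset (Fin d)) :
    vertexFactor (∑ i ∈ T, P i) s = ∑ i ∈ T, vertexFactor (P i) s := by
  simp [vertexFactor, Finset.mul_sum]

/-- Identifies `vertexFactor P s` with the iterated derivative of `P` at `0`: the new factor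
`s.count b + 1` in the factorials is the one that differentiation by `b` produces. -/
lemma vertexFactor_cons (P : MvPowerSeries (Fin d) ℝ) (b : Fin d) (s : Multiset (Fin d)) :
    vertexFactor P (b ::ₘ s) = vertexFactor (MvPowerSeries.pderiv ℝ b P) s := by
  have h1 : Multiset.toFinsupp (b ::ₘ s) = Multiset.toFinsupp s + Finsupp.single b 1 := by
    rw [← Multiset.singleton_add, Multiset.toFinsupp_add, Multiset.toFinsupp_singleton, add_comm]
  have h2 : (∏ i, (((b ::ₘ s).count i)! : ℝ)) = (∏ i, ((s.count i)! : ℝ)) * (s.count b + 1) := by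
    rw [← Finset.mul_prod_erase _ _ (Finset.mem_univ b),
      ← Finset.mul_prod_erase (a := b) (f := fun i => ((s.count i)! : ℝ)) _ (Finset.mem_univ b),
      Multiset.count_cons_self, Nat.factorial_succ]
    have : ∏ i ∈ Finset.univ.erase b, (((b ::ₘ s).count i)! : ℝ) =
        ∏ i ∈ Finset.univ.erase b, ((s.count i)! : ℝ) :=
      Finset.prod_congr rfl fun i hi => by
        rw [Multiset.count_cons_of_ne (Finset.ne_of_mem_erase hi)]
    rw [this]
    push_cast
    ring
  rw [vertexFactor, vertexFactor, MvPowerSeries.coeff_pderiv, h1, h2, Multiset.toFinsupp_apply]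
  ring

lemma vertexFactor_X (i : Fin d) (s : Multiset (Fin d)) :
    vertexFactor (MvPowerSeries.X i) s = if s = {i} then 1 else 0 := by
  rw [vertexFactor, MvPowerSeries.coeff_X]
  have : Multiset.toFinsupp s = Finsupp.single i 1 ↔ s = {i} := by
    rw [← Multiset.toFinsupp_singleton, Multiset.toFinsupp.injective.eq_iff]
  simp only [this]
  split_ifs with h
  · subst h
    rw [mul_one]
    refine Finset.prod_eq_one fun j _ => ?_
    rw [Multiset.count_singleton]
    split_ifs <;> simp
  · simp

lemma pderiv_prod {X : Type*} [DecidableEq X] (T : Finset X) (b : Fin d)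
    (P : X → MvPowerSeries (Fin d) ℝ) :
    MvPowerSeries.pderiv ℝ b (∏ x ∈ T, P x) =
      ∑ x ∈ T, ∏ y ∈ T, if x = y then MvPowerSeries.pderiv ℝ b (P y) else P y := by
  induction T using Finset.induction_on with
  | empty => simp
  | insert z T hz ih =>
    rw [Finset.prod_insert hz, Derivation.leibniz, ih, Finset.sum_insert hz, Finset.prod_insert hz]
    have h1 : ∏ y ∈ T, (if z = y then MvPowerSeries.pderiv ℝ b (P y) else P y) = ∏ y ∈ T, P y :=
      Finset.prod_congr rfl fun y hy => if_neg (ne_of_mem_of_not_mem hy hz).symm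
    have h2 : ∀ x ∈ T, ∏ y ∈ insert z T, (if x = y then MvPowerSeries.pderiv ℝ b (P y) else P y) =
        P z * ∏ y ∈ T, (if x = y then MvPowerSeries.pderiv ℝ b (P y) else P y) := by
      intro x hx
      rw [Finset.prod_insert hz, if_neg (ne_of_mem_of_not_mem hx hz)]
    rw [Finset.sum_congr rfl h2, h1, ← Finset.mul_sum]
    simp only [smul_eq_mul, if_true]
    ring

/-- The labels `l h` of the elements `h` attached to `x` by `a`. -/
def starLabels {H X D : Type*} [Fintype H] [DecidableEq X] (a : H → X) (l : H → D) (x : X) :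
    Multiset D :=
  ∑ h, if a h = x then {l h} else 0

lemma starLabels_comp_equiv {H H' X D : Type*} [Fintype H] [Fintype H'] [DecidableEq X]
    (e : H' ≃ H) (a : H → X) (l : H → D) (x : X) :
    starLabels (a ∘ e) (l ∘ e) x = starLabels a l x :=
  e.sum_comp fun h => if a h = x then ({l h} : Multiset D) else 0

lemma starLabels_eq_map {H X D : Type*} [Fintype H] [DecidableEq X] (a : H → X) (l : H → D)
    (x : X) : starLabels a l x = (Finset.univ.filter fun h => a h = x).val.map l := by
  rw [starLabels, ← Finset.sum_filter, Finset.sum_eq_multiset_sum]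
  exact (congrArg Multiset.sum (Multiset.map_map _ _ _).symm).trans (Multiset.sum_map_singleton _)

/-- Each successive derivative chooses the factor it hits; the record of these choices is the map
`a`. -/
lemma vertexFactor_prod_fin {X : Type*} [Fintype X] [DecidableEq X] (N : ℕ) (l : Fin N → Fin d)
    (P : X → MvPowerSeries (Fin d) ℝ) :
    vertexFactor (∏ x, P x) (∑ h, {l h}) =
      ∑ a : Fin N → X, ∏ x, vertexFactor (P x) (starLabels a l x) := by
  induction N generalizing P with
  | zero => simp [starLabels, vertexFactor_zero]
  | succ N ih =>
    rw [Fin.sum_univ_succ, Multiset.singleton_add, vertexFactor_cons, pderiv_prod, vertexFactor_sum,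
      ← (Fin.consEquiv fun _ => X).sum_comp, Fintype.sum_prod_type]
    refine Finset.sum_congr rfl fun x _ => ?_
    rw [ih]
    refine Finset.sum_congr rfl fun a _ => Finset.prod_congr rfl fun y _ => ?_
    rw [starLabels, starLabels, Fin.sum_univ_succ]
    simp only [Fin.consEquiv, Equiv.coe_fn_mk, Fin.cons_zero, Fin.cons_succ]
    split_ifs with h
    · rw [Multiset.singleton_add, vertexFactor_cons]
    · rw [zero_add]

/-- The Leibniz rule. -/
lemma vertexFactor_prod {H X : Type*} [Fintype H] [DecidableEq H] [Fintype X] [DecidableEq X]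
    (l : H → Fin d) (P : X → MvPowerSeries (Fin d) ℝ) :
    vertexFactor (∏ x, P x) (∑ h, {l h}) =
      ∑ a : H → X, ∏ x, vertexFactor (P x) (starLabels a l x) := by
  have e := (Fintype.equivFin H).symm
  rw [← e.sum_comp (fun h => ({l h} : Multiset (Fin d))),
    show ∑ i, ({l (e i)} : Multiset (Fin d)) = ∑ i, {(l ∘ e) i} from rfl,
    vertexFactor_prod_fin _ (l ∘ e) P,
    ← (e.arrowCongr (Equiv.refl X)).sum_comp]
  refine Finset.sum_congr rfl fun a _ => Finset.prod_congr rfl fun x _ => ?_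
  rw [← starLabels_comp_equiv e]
  congr 2
  ext h
  simp

/-- The weight of a graph with half-edges attached to vertices by `a`, with vertex functions `w` and
propagator `g`. -/
def graphWeight {ι X : Type*} [Fintype ι] [DecidableEq ι] [Fintype X] [DecidableEq X]
    (g : Matrix (Fin d) (Fin d) ℝ) (w : X → Multiset (Fin d) → ℝ) (a : ι × Bool → X) : ℝ :=
  ∑ l : ι × Bool → Fin d, (∏ x, w x (starLabels a l x)) * ∏ e, g (l (e, false)) (l (e, true))

/-- Each of the `E` operators supplies one edge with a pair of labels and one propagator. -/
lemma constantCoeff_laplace_pow_fin (g : Matrix (Fin d) (Fin d) ℝ) (E : ℕ)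
    (p : MvPolynomial (Fin d) ℝ) :
    MvPolynomial.constantCoeff ((laplace g ^ E) p) =
      ∑ l : Fin E → Fin d × Fin d, vertexFactor p (∑ e, {(l e).1, (l e).2}) *
        ∏ e, g (l e).1 (l e).2 := by
  induction E generalizing p with
  | zero =>
    simp [vertexFactor_zero, ← MvPowerSeries.coeff_zero_eq_constantCoeff_apply,
      MvPolynomial.constantCoeff_eq]
  | succ E ih =>
    rw [pow_succ, Module.End.mul_apply, ih, ← (Fin.consEquiv fun _ => Fin d × Fin d).sum_comp,
      Fintype.sum_prod_type, Finset.sum_comm]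
    refine Finset.sum_congr rfl fun l _ => ?_
    rw [laplace_apply, Fintype.sum_prod_type]
    have hcoe : ((∑ a, ∑ b, g a b • MvPolynomial.pderiv a (MvPolynomial.pderiv b p) :
        MvPolynomial (Fin d) ℝ) : MvPowerSeries (Fin d) ℝ) = ∑ a, ∑ b, g a b •
          MvPowerSeries.pderiv ℝ a (MvPowerSeries.pderiv ℝ b (p : MvPowerSeries (Fin d) ℝ)) := by
      rw [← MvPolynomial.coeToMvPowerSeries.ringHom_apply, map_sum]
      refine Finset.sum_congr rfl fun a _ => ?_
      rw [map_sum]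
      refine Finset.sum_congr rfl fun b _ => ?_
      rw [MvPowerSeries.pderiv_coe, MvPowerSeries.pderiv_coe,
        MvPolynomial.coeToMvPowerSeries.ringHom_apply, MvPolynomial.coe_smul]
    rw [hcoe, vertexFactor_sum, Finset.sum_mul]
    refine Finset.sum_congr rfl fun a _ => ?_
    rw [vertexFactor_sum, Finset.sum_mul]
    refine Finset.sum_congr rfl fun b _ => ?_
    rw [vertexFactor_smul, Fin.sum_univ_succ, Fin.prod_univ_succ]
    simp only [Fin.consEquiv, Equiv.coe_fn_mk, Fin.cons_zero, Fin.cons_succ]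
    have : ({a, b} : Multiset (Fin d)) + ∑ e, {(l e).1, (l e).2} =
        b ::ₘ a ::ₘ ∑ e, {(l e).1, (l e).2} := by
      rw [Multiset.insert_eq_cons, Multiset.cons_add, Multiset.singleton_add, Multiset.cons_swap]
    rw [this, vertexFactor_cons, vertexFactor_cons]
    ring

lemma constantCoeff_laplace_pow (g : Matrix (Fin d) (Fin d) ℝ) (E : ℕ)
    (p : MvPolynomial (Fin d) ℝ) :
    MvPolynomial.constantCoeff ((laplace g ^ E) p) =
      ∑ l : Fin E × Bool → Fin d, vertexFactor p (∑ h, {l h}) *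
        ∏ e, g (l (e, false)) (l (e, true)) := by
  rw [constantCoeff_laplace_pow_fin]
  refine (Fintype.sum_equiv ((Equiv.curry _ _ _).trans
    ((Equiv.refl _).arrowCongr (Equiv.boolArrowEquivProd _))) _ _ fun l => ?_).symm
  simp only [Fintype.sum_prod_type, Fintype.sum_bool]
  simp only [Equiv.trans_apply, Equiv.curry_apply, Equiv.arrowCongr_apply, Equiv.coe_refl,
    Function.comp_apply, Equiv.refl_symm, Equiv.boolArrowEquivProd_apply, Function.curry_apply, id]
  congr 3
  ext e : 1
  rw [add_comm]
  rfl

/-- Evaluation at `0` after `2E` derivatives sees only the part of degree `2E`. The hypothesis asks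
for agreement in that degree alone, so that `p` may be a homogeneous component of a product of power
series. -/
lemma constantCoeff_laplace_pow_prod {X : Type*} [Fintype X] [DecidableEq X]
    (g : Matrix (Fin d) (Fin d) ℝ) (E : ℕ) (p : MvPolynomial (Fin d) ℝ)
    (P : X → MvPowerSeries (Fin d) ℝ)
    (hp : ∀ s : Multiset (Fin d), s.card = 2 * E → vertexFactor p s = vertexFactor (∏ x, P x) s) :
    MvPolynomial.constantCoeff ((laplace g ^ E) p) =
      ∑ a : Fin E × Bool → X, graphWeight g (fun x => vertexFactor (P x)) a := by
  have h1 : ∀ l : Fin E × Bool → Fin d, vertexFactor p (∑ h, {l h}) =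
      vertexFactor (∏ x, P x) (∑ h, {l h}) := fun l => hp _ (by simp [mul_comm])
  simp only [constantCoeff_laplace_pow, h1, vertexFactor_prod, graphWeight, Finset.sum_mul]
  rw [Finset.sum_comm]

end VertexFactor

/-! ### Splitting off the vacuum components -/

section Connected

variable {ι ι' L V V' : Type*}

/-- The set `S` of internal vertices, together with all legs, is closed under passing to the other
end of an edge. -/
def IsClosedSet (a : ι × Bool → L ⊕ V) (S : Set V) : Prop :=
  ∀ e b, Sum.elim (fun _ => True) (· ∈ S) (a (e, b)) →
    Sum.elim (fun _ => True) (· ∈ S) (a (e, !b))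

/-- Every internal vertex is connected to some leg. -/
def LegConnected (a : ι × Bool → L ⊕ V) : Prop :=
  ∀ S : Set V, IsClosedSet a S → S = Set.univ

/-- The graph with internal vertices and edges transported along bijections. -/
def transport (σ : V ≃ V') (τ : ι ≃ ι') : (ι × Bool → L ⊕ V) ≃ (ι' × Bool → L ⊕ V') :=
  (τ.prodCongr (Equiv.refl Bool)).arrowCongr ((Equiv.refl L).sumCongr σ)

lemma transport_apply (σ : V ≃ V') (τ : ι ≃ ι') (a : ι × Bool → L ⊕ V) (e : ι') (b : Bool) :
    transport σ τ a (e, b) = Sum.map id σ (a (τ.symm e, b)) := rfl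

lemma isClosedSet_transport (σ : V ≃ V') (τ : ι ≃ ι') (a : ι × Bool → L ⊕ V) (S : Set V') :
    IsClosedSet (transport σ τ a) S ↔ IsClosedSet a (σ ⁻¹' S) := by
  have h : ∀ e b, Sum.elim (fun _ => True) (· ∈ S) (transport σ τ a (e, b)) ↔
      Sum.elim (fun _ => True) (· ∈ σ ⁻¹' S) (a (τ.symm e, b)) := by
    intro e b
    rw [transport_apply]
    rcases a (τ.symm e, b) with j | v <;> rfl
  simp only [IsClosedSet, h]
  exact ⟨fun H e => by simpa using H (τ e), fun H e => H _⟩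

lemma legConnected_transport (σ : V ≃ V') (τ : ι ≃ ι') (a : ι × Bool → L ⊕ V) :
    LegConnected (transport σ τ a) ↔ LegConnected a := by
  constructor
  · intro H S hS
    have := H (σ.symm ⁻¹' S) ((isClosedSet_transport σ τ a _).2 (by
      rwa [← Set.preimage_comp, Equiv.symm_comp_self, Set.preimage_id]))
    rw [← Set.preimage_univ (f := σ), ← this, ← Set.preimage_comp, Equiv.symm_comp_self,
      Set.preimage_id]
  · intro H S hS
    have := H _ ((isClosedSet_transport σ τ a S).1 hS)
    rw [← Set.preimage_eq_preimage σ.surjective, this, Set.preimage_univ]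

/-- The disjoint union of a graph with legs and a graph without legs. -/
def glueSum {ι₁ ι₂ V₁ V₂ : Type*} (a₁ : ι₁ × Bool → L ⊕ V₁) (a₂ : ι₂ × Bool → V₂) :
    (ι₁ ⊕ ι₂) × Bool → L ⊕ (V₁ ⊕ V₂)
  | (Sum.inl e, b) => Sum.map id Sum.inl (a₁ (e, b))
  | (Sum.inr e, b) => Sum.inr (Sum.inr (a₂ (e, b)))

lemma glueSum_injective {ι₁ ι₂ V₁ V₂ : Type*} : Function.Injective
    fun p : (ι₁ × Bool → L ⊕ V₁) × (ι₂ × Bool → V₂) => glueSum p.1 p.2 := by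
  rintro ⟨a₁, a₂⟩ ⟨b₁, b₂⟩ h
  have hinj : Function.Injective (Sum.map (id : L → L) (Sum.inl : V₁ → V₁ ⊕ V₂)) :=
    Function.Injective.sumMap Function.injective_id Sum.inl_injective
  refine Prod.ext (funext fun x => ?_) (funext fun x => ?_)
  · exact hinj (congrFun h (Sum.inl x.1, x.2))
  · simpa [glueSum] using congrFun h (Sum.inr x.1, x.2)

section Weight

variable {d : ℕ} {X X' : Type*}
variable [Fintype ι] [DecidableEq ι] [Fintype ι'] [DecidableEq ι'] [Fintype X] [DecidableEq X]
  [Fintype X'] [DecidableEq X']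

lemma graphWeight_congr (g : Matrix (Fin d) (Fin d) ℝ) (w : X → Multiset (Fin d) → ℝ)
    (w' : X' → Multiset (Fin d) → ℝ) (σ : X ≃ X') (hw : ∀ x, w' (σ x) = w x) (τ : ι ≃ ι')
    (a : ι × Bool → X) (a' : ι' × Bool → X') (ha : ∀ e b, a' (τ e, b) = σ (a (e, b))) :
    graphWeight g w' a' = graphWeight g w a := by
  rw [graphWeight, graphWeight,
    ← ((τ.prodCongr (Equiv.refl Bool)).arrowCongr (Equiv.refl (Fin d))).sum_comp]
  refine Finset.sum_congr rfl fun l _ => ?_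
  rw [← σ.prod_comp, ← τ.prod_comp]
  congr 1
  · refine Finset.prod_congr rfl fun x _ => ?_
    rw [hw, ← starLabels_comp_equiv (τ.prodCongr (Equiv.refl Bool)), starLabels, starLabels]
    congr 1
    refine Finset.sum_congr rfl fun h _ => ?_
    obtain ⟨e, b⟩ := h
    simp [ha, Equiv.arrowCongr]
  · refine Finset.prod_congr rfl fun e _ => ?_
    simp [Equiv.arrowCongr]

end Weight

section Split

variable {d : ℕ} {ι₁ ι₂ V₁ V₂ : Type*}
variable [Fintype ι₁] [DecidableEq ι₁] [Fintype ι₂] [DecidableEq ι₂] [Fintype V₁] [DecidableEq V₁]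
  [Fintype V₂] [DecidableEq V₂] [Fintype L] [DecidableEq L]

/-- A labelling of a disjoint union is a pair of labellings, and the star of every vertex lies in
one of the two parts. -/
lemma graphWeight_glueSum (g : Matrix (Fin d) (Fin d) ℝ) (wL : L → Multiset (Fin d) → ℝ)
    (w : Multiset (Fin d) → ℝ) (a₁ : ι₁ × Bool → L ⊕ V₁) (a₂ : ι₂ × Bool → V₂) :
    graphWeight g (Sum.elim wL fun _ => w) (glueSum a₁ a₂) =
      graphWeight g (Sum.elim wL fun _ => w) a₁ * graphWeight g (fun _ => w) a₂ := by
  rw [graphWeight, graphWeight, graphWeight, Finset.sum_mul_sum, ← Finset.sum_product',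
    Finset.univ_product_univ]
  refine Fintype.sum_equiv (((Equiv.sumProdDistrib ι₁ ι₂ Bool).arrowCongr (Equiv.refl _)).trans
    (Equiv.sumArrowEquivProdArrow _ _ _)) _ _ fun l => ?_
  set l₁ : ι₁ × Bool → Fin d := fun h => l (Sum.inl h.1, h.2)
  set l₂ : ι₂ × Bool → Fin d := fun h => l (Sum.inr h.1, h.2)
  change _ = ((∏ x, Sum.elim wL (fun _ => w) x (starLabels a₁ l₁ x)) *
      ∏ e, g (l₁ (e, false)) (l₁ (e, true))) *
    ((∏ x, w (starLabels a₂ l₂ x)) * ∏ e, g (l₂ (e, false)) (l₂ (e, true)))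
  have hL : ∀ j, starLabels (glueSum a₁ a₂) l (Sum.inl j) = starLabels a₁ l₁ (Sum.inl j) := by
    intro j
    simp only [starLabels, Fintype.sum_prod_type, Fintype.sum_sum_type, glueSum, reduceCtorEq,
      if_false, Finset.sum_const_zero, add_zero]
    refine Finset.sum_congr rfl fun e _ => Finset.sum_congr rfl fun b _ => ?_
    simp only [show Sum.map id Sum.inl (a₁ (e, b)) = (Sum.inl j : L ⊕ (V₁ ⊕ V₂)) ↔
      a₁ (e, b) = Sum.inl j by rcases a₁ (e, b) with k | v <;> simp]
    rfl
  have h1 : ∀ v, starLabels (glueSum a₁ a₂) l (Sum.inr (Sum.inl v)) =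
      starLabels a₁ l₁ (Sum.inr v) := by
    intro j
    simp only [starLabels, Fintype.sum_prod_type, Fintype.sum_sum_type, glueSum, reduceCtorEq,
      Sum.inr.injEq, if_false, Finset.sum_const_zero, add_zero]
    refine Finset.sum_congr rfl fun e _ => Finset.sum_congr rfl fun b _ => ?_
    simp only [show Sum.map id Sum.inl (a₁ (e, b)) = (Sum.inr (Sum.inl j) : L ⊕ (V₁ ⊕ V₂)) ↔
      a₁ (e, b) = Sum.inr j by rcases a₁ (e, b) with k | v <;> simp]
    rfl
  have h2 : ∀ v, starLabels (glueSum a₁ a₂) l (Sum.inr (Sum.inr v)) = starLabels a₂ l₂ v := by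
    intro j
    simp only [starLabels, Fintype.sum_prod_type, Fintype.sum_sum_type, glueSum, Sum.inr.injEq]
    rw [Finset.sum_eq_zero (s := (Finset.univ : Finset ι₁)), zero_add]
    intro e _
    refine Finset.sum_eq_zero fun b _ => ?_
    exact if_neg (by rcases a₁ (e, b) with k | v <;> simp)
  simp only [Fintype.prod_sum_type, Sum.elim_inl, Sum.elim_inr, hL, h1, h2]
  simp only [l₁, l₂]
  ring

end Split

/-! ### Unique decomposition of a graph along its leg-connected part -/

section Decomposition

/-- The disjoint union of a graph with legs on `S` and `F` and a graph without legs on the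
complements. -/
def glue (S : Finset V) (F : Finset ι) [DecidablePred (· ∈ S)] [DecidablePred (· ∈ F)]
    (a₁ : {e // e ∈ F} × Bool → L ⊕ {v // v ∈ S})
    (a₂ : {e // e ∉ F} × Bool → {v // v ∉ S}) : ι × Bool → L ⊕ V :=
  transport (Equiv.sumCompl (· ∈ S)) (Equiv.sumCompl (· ∈ F)) (glueSum a₁ a₂)

variable {S : Finset V} {F : Finset ι} [DecidablePred (· ∈ S)] [DecidablePred (· ∈ F)]
  {a₁ : {e // e ∈ F} × Bool → L ⊕ {v // v ∈ S}} {a₂ : {e // e ∉ F} × Bool → {v // v ∉ S}}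

lemma glue_of_mem {e : ι} (he : e ∈ F) (b : Bool) :
    glue S F a₁ a₂ (e, b) = Sum.map id Subtype.val (a₁ (⟨e, he⟩, b)) := by
  rw [glue, transport_apply, Equiv.sumCompl_symm_apply_of_pos he, glueSum]
  rcases a₁ (⟨e, he⟩, b) with j | v <;> rfl

lemma glue_of_notMem {e : ι} (he : e ∉ F) (b : Bool) :
    glue S F a₁ a₂ (e, b) = Sum.inr (a₂ (⟨e, he⟩, b)).1 := by
  rw [glue, transport_apply, Equiv.sumCompl_symm_apply_of_neg he, glueSum]
  rfl

lemma elim_glue_iff (e : ι) (b : Bool) :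
    Sum.elim (fun _ => True) (· ∈ (S : Set V)) (glue S F a₁ a₂ (e, b)) ↔ e ∈ F := by
  by_cases he : e ∈ F
  · rw [glue_of_mem he]
    rcases a₁ (⟨e, he⟩, b) with j | v <;> simp [he]
  · rw [glue_of_notMem he]
    simp [he, (a₂ (⟨e, he⟩, b)).2]

variable [Fintype V]

open Classical in
/-- The internal vertices connected to legs. -/
def legVertices (a : ι × Bool → L ⊕ V) : Finset V :=
  Finset.univ.filter fun v => ∀ S : Set V, IsClosedSet a S → v ∈ S

lemma mem_legVertices {a : ι × Bool → L ⊕ V} {v : V} :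
    v ∈ legVertices a ↔ ∀ S : Set V, IsClosedSet a S → v ∈ S := by
  simp [legVertices]

lemma isClosedSet_legVertices (a : ι × Bool → L ⊕ V) : IsClosedSet a (legVertices a) := by
  intro e b h
  rcases h1 : a (e, !b) with j | v
  · trivial
  · change v ∈ legVertices a
    rw [mem_legVertices]
    intro S hS
    have h2 : Sum.elim (fun _ => True) (· ∈ S) (a (e, !b)) := by
      apply hS
      rcases h3 : a (e, b) with j | u
      · trivial
      · rw [h3] at h
        exact mem_legVertices.1 h S hS
    rwa [h1] at h2

/-- `S` is closed in the glued graph; conversely a closed set of the glued graph restricts to a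
closed set of `a₁`, which is everything. With `legEdges_glue`, this recovers `S` and `F` from the
glued graph. -/
lemma legVertices_glue (h : LegConnected a₁) : legVertices (glue S F a₁ a₂) = S := by
  ext v
  rw [mem_legVertices]
  constructor
  · intro H
    refine H S fun e b => ?_
    rw [elim_glue_iff, elim_glue_iff]
    exact id
  · intro hv S' hS'
    have h1 := h (Subtype.val ⁻¹' S') ?_
    · have : (⟨v, hv⟩ : {v // v ∈ S}) ∈ Subtype.val ⁻¹' S' := h1 ▸ Set.mem_univ _
      exact this
    · intro e b
      have h2 : ∀ b, Sum.elim (fun _ => True) (· ∈ Subtype.val ⁻¹' S') (a₁ (e, b)) ↔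
          Sum.elim (fun _ => True) (· ∈ S') (glue S F a₁ a₂ (e.1, b)) := by
        intro b
        rw [glue_of_mem e.2]
        rcases a₁ (e, b) with j | v <;> rfl
      rw [h2, h2]
      exact hS' _ _

variable [Fintype ι]

open Classical in
/-- The edges connected to legs. -/
def legEdges (a : ι × Bool → L ⊕ V) : Finset ι :=
  Finset.univ.filter fun e =>
    Sum.elim (fun _ => True) (· ∈ (legVertices a : Set V)) (a (e, false))

lemma mem_legEdges {a : ι × Bool → L ⊕ V} {e : ι} :
    e ∈ legEdges a ↔ Sum.elim (fun _ => True) (· ∈ (legVertices a : Set V)) (a (e, false)) := by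
  simp [legEdges]

lemma mem_legEdges' {a : ι × Bool → L ⊕ V} {e : ι} (b : Bool) :
    e ∈ legEdges a ↔ Sum.elim (fun _ => True) (· ∈ (legVertices a : Set V)) (a (e, b)) := by
  rw [mem_legEdges]
  have h := isClosedSet_legVertices a e
  cases b
  · rfl
  · exact ⟨h false, h true⟩

lemma legEdges_glue (h : LegConnected a₁) : legEdges (glue S F a₁ a₂) = F := by
  ext e
  rw [mem_legEdges, legVertices_glue h, elim_glue_iff]

/-- No edge joins the leg-connected part to the rest, so `a` restricts to both parts. A closed set
of the first restriction is still closed in `a`, hence contains all of `legVertices a`. -/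
lemma exists_glue (a : ι × Bool → L ⊕ V)
    (hS : legVertices a = S) (hF : legEdges a = F) :
    ∃ (a₁ : {e // e ∈ F} × Bool → L ⊕ {v // v ∈ S}) (a₂ : {e // e ∉ F} × Bool → {v // v ∉ S}),
      LegConnected a₁ ∧ glue S F a₁ a₂ = a := by
  have hmem : ∀ e b, e ∈ F ↔ Sum.elim (fun _ => True) (· ∈ (S : Set V)) (a (e, b)) := by
    intro e b
    rw [← hF, ← hS]
    exact mem_legEdges' b
  have h1 : ∀ h : {e // e ∈ F} × Bool, ∃ y : L ⊕ {v // v ∈ S},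
      Sum.map id Subtype.val y = a (h.1.1, h.2) := by
    intro h
    have := (hmem h.1.1 h.2).1 h.1.2
    rcases hx : a (h.1.1, h.2) with j | v
    · exact ⟨Sum.inl j, rfl⟩
    · rw [hx] at this
      exact ⟨Sum.inr ⟨v, this⟩, rfl⟩
  have h2 : ∀ h : {e // e ∉ F} × Bool, ∃ y : {v // v ∉ S}, Sum.inr y.1 = a (h.1.1, h.2) := by
    intro h
    have := mt (hmem h.1.1 h.2).2 h.1.2
    rcases hx : a (h.1.1, h.2) with j | v
    · rw [hx] at this
      exact absurd trivial this
    · rw [hx] at this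
      exact ⟨⟨v, this⟩, rfl⟩
  choose a₁ ha₁ using h1
  choose a₂ ha₂ using h2
  refine ⟨a₁, a₂, ?_, ?_⟩
  · intro S' hS'
    have hcl : IsClosedSet a (Subtype.val '' S') := by
      intro e b h
      have he : e ∈ F := by
        rw [hmem e b]
        rcases hx : a (e, b) with j | v
        · trivial
        · rw [hx] at h
          obtain ⟨u, -, rfl⟩ := h
          exact u.2
      have h3 : ∀ b, Sum.elim (fun _ => True) (· ∈ Subtype.val '' S') (a (e, b)) ↔
          Sum.elim (fun _ => True) (· ∈ S') (a₁ (⟨e, he⟩, b)) := by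
        intro b
        rw [← ha₁ (⟨e, he⟩, b)]
        rcases a₁ (⟨e, he⟩, b) with j | v <;> simp
      rw [h3] at h ⊢
      exact hS' _ _ h
    ext v
    simp only [Set.mem_univ, iff_true]
    have hv : v.1 ∈ legVertices a := hS ▸ v.2
    obtain ⟨u, hu, huv⟩ := mem_legVertices.1 hv _ hcl
    rwa [← Subtype.ext huv]
  · ext1 ⟨e, b⟩
    by_cases he : e ∈ F
    · rw [glue_of_mem he, ha₁]
    · rw [glue_of_notMem he, ha₂]

end Decomposition

/-! ### Factorization of the sum over all graphs -/

section Sums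

variable {d : ℕ} [Fintype L] [DecidableEq L]

open Classical in
/-- The sum of the weights of all graphs on given edges and vertices in which every vertex is
connected to a leg. -/
def connSum (g : Matrix (Fin d) (Fin d) ℝ) (wL : L → Multiset (Fin d) → ℝ)
    (w : Multiset (Fin d) → ℝ) (ι V : Type*) [Fintype ι] [DecidableEq ι] [Fintype V]
    [DecidableEq V] : ℝ :=
  ∑ a : ι × Bool → L ⊕ V with LegConnected a, graphWeight g (Sum.elim wL fun _ => w) a

/-- The sum of the weights of all graphs without legs on given edges and vertices. -/
def vacSum (g : Matrix (Fin d) (Fin d) ℝ) (w : Multiset (Fin d) → ℝ) (ι V : Type*) [Fintype ι]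
    [DecidableEq ι] [Fintype V] [DecidableEq V] : ℝ :=
  ∑ a : ι × Bool → V, graphWeight g (fun _ => w) a

variable [Fintype ι] [DecidableEq ι] [Fintype V] [DecidableEq V]
  [Fintype ι'] [DecidableEq ι'] [Fintype V'] [DecidableEq V']

lemma connSum_congr (g : Matrix (Fin d) (Fin d) ℝ) (wL : L → Multiset (Fin d) → ℝ)
    (w : Multiset (Fin d) → ℝ) (τ : ι ≃ ι') (σ : V ≃ V') :
    connSum g wL w ι V = connSum g wL w ι' V' := by
  refine Finset.sum_equiv (transport σ τ) (fun a => ?_) fun a _ => ?_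
  · simp [legConnected_transport]
  · refine (graphWeight_congr g _ _ ((Equiv.refl L).sumCongr σ) ?_ τ _ _ ?_).symm
    · rintro (j | v) <;> rfl
    · intro e b
      rw [transport_apply, Equiv.symm_apply_apply]
      rfl

lemma vacSum_congr (g : Matrix (Fin d) (Fin d) ℝ) (w : Multiset (Fin d) → ℝ) (τ : ι ≃ ι')
    (σ : V ≃ V') : vacSum g w ι V = vacSum g w ι' V' := by
  refine Fintype.sum_equiv ((τ.prodCongr (Equiv.refl Bool)).arrowCongr σ) _ _ fun a => ?_
  refine (graphWeight_congr g (fun _ => w) (fun _ => w) σ (fun _ => rfl) τ _ _ ?_).symm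
  intro e b
  simp [Equiv.arrowCongr]

lemma graphWeight_glue (g : Matrix (Fin d) (Fin d) ℝ) (wL : L → Multiset (Fin d) → ℝ)
    (w : Multiset (Fin d) → ℝ) {S : Finset V} {F : Finset ι}
    (a₁ : {e // e ∈ F} × Bool → L ⊕ {v // v ∈ S}) (a₂ : {e // e ∉ F} × Bool → {v // v ∉ S}) :
    graphWeight g (Sum.elim wL fun _ => w) (glue S F a₁ a₂) =
      graphWeight g (Sum.elim wL fun _ => w) a₁ * graphWeight g (fun _ => w) a₂ := by
  rw [← graphWeight_glueSum]
  refine graphWeight_congr g _ _ ((Equiv.refl L).sumCongr (Equiv.sumCompl (· ∈ S))) ?_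
    (Equiv.sumCompl (· ∈ F)) _ _ ?_
  · rintro (j | v) <;> rfl
  · intro e b
    rw [glue, transport_apply, Equiv.symm_apply_apply]
    rfl

/-- Attaching maps are grouped by `(legVertices a, legEdges a)`; `glue` parametrizes each fibre
bijectively. -/
lemma sum_graphWeight_eq_sum_finset (g : Matrix (Fin d) (Fin d) ℝ)
    (wL : L → Multiset (Fin d) → ℝ) (w : Multiset (Fin d) → ℝ) :
    ∑ a : ι × Bool → L ⊕ V, graphWeight g (Sum.elim wL fun _ => w) a =
      ∑ S : Finset V, ∑ F : Finset ι, connSum g wL w {e // e ∈ F} {v // v ∈ S} *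
        vacSum g w {e // e ∉ F} {v // v ∉ S} := by
  classical
  rw [← Finset.sum_fiberwise (Finset.univ : Finset (ι × Bool → L ⊕ V))
    (fun a => (legVertices a, legEdges a)), Fintype.sum_prod_type]
  refine Finset.sum_congr rfl fun S _ => Finset.sum_congr rfl fun F _ => ?_
  rw [connSum, vacSum, Finset.sum_mul_sum, ← Finset.sum_product']
  refine (Finset.sum_of_injOn (fun p : ({e // e ∈ F} × Bool → L ⊕ {v // v ∈ S}) ×
    ({e // e ∉ F} × Bool → {v // v ∉ S}) => glue S F p.1 p.2) ?_ ?_ ?_ ?_).symm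
  · exact ((transport _ _).injective.comp glueSum_injective).injOn
  · rintro ⟨a₁, a₂⟩ h
    have h1 : LegConnected a₁ := by simpa using h
    simp [legVertices_glue h1, legEdges_glue h1]
  · intro a ha h
    refine absurd ?_ h
    simp only [Finset.mem_filter, Finset.mem_univ, true_and, Prod.mk.injEq] at ha
    obtain ⟨a₁, a₂, h1, h2⟩ := exists_glue a ha.1 ha.2
    exact ⟨(a₁, a₂), by simp [h1], h2⟩
  · rintro ⟨a₁, a₂⟩ -
    exact (graphWeight_glue g wL w a₁ a₂).symm

/-- The normalized sum over graphs with `n` internal vertices and `E` edges in which every vertex is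
connected to a leg. -/
def connCoeff (g : Matrix (Fin d) (Fin d) ℝ) (wL : L → Multiset (Fin d) → ℝ)
    (w : Multiset (Fin d) → ℝ) (n E : ℕ) : ℝ :=
  ((n ! : ℝ) * ((E ! : ℝ) * 2 ^ E))⁻¹ * connSum g wL w (Fin E) (Fin n)

/-- The normalized sum over graphs without legs with `n` vertices and `E` edges. -/
def vacCoeff (g : Matrix (Fin d) (Fin d) ℝ) (w : Multiset (Fin d) → ℝ) (n E : ℕ) : ℝ :=
  ((n ! : ℝ) * ((E ! : ℝ) * 2 ^ E))⁻¹ * vacSum g w (Fin E) (Fin n)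

/-- The sum over all graphs factors into the sum over graphs without vacuum components and the sum
over vacuum graphs. -/
lemma sum_graphWeight_eq (g : Matrix (Fin d) (Fin d) ℝ)
    (wL : L → Multiset (Fin d) → ℝ) (w : Multiset (Fin d) → ℝ) (n E : ℕ) :
    ((n ! : ℝ) * ((E ! : ℝ) * 2 ^ E))⁻¹ *
      ∑ a : Fin E × Bool → L ⊕ Fin n, graphWeight g (Sum.elim wL fun _ => w) a =
      ∑ x ∈ Finset.HasAntidiagonal.antidiagonal n, ∑ y ∈ Finset.HasAntidiagonal.antidiagonal E,
        connCoeff g wL w x.1 y.1 * vacCoeff g w x.2 y.2 := by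
  have hcard : ∀ {k : ℕ} (T : Finset (Fin k)), Fintype.card {e // e ∉ T} = k - T.card := by
    intro k T
    rw [Fintype.card_subtype_compl, Fintype.card_fin, Fintype.card_coe]
  have h1 : ∀ (S : Finset (Fin n)) (F : Finset (Fin E)),
      connSum g wL w {e // e ∈ F} {v // v ∈ S} * vacSum g w {e // e ∉ F} {v // v ∉ S} =
      connSum g wL w (Fin F.card) (Fin S.card) *
        vacSum g w (Fin (E - F.card)) (Fin (n - S.card)) := by
    intro S F
    rw [connSum_congr g wL w F.equivFin S.equivFin,
      vacSum_congr g w (Fintype.equivFinOfCardEq (hcard F)) (Fintype.equivFinOfCardEq (hcard S))]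
  rw [sum_graphWeight_eq_sum_finset]
  simp only [h1]
  -- The summands depend only on the sizes of `S` and `F`, so subsets are counted by binomials,
  -- which split `1 / n!` and `1 / E!` between the two parts.
  have h2 : ∀ (k : ℕ) (f : ℕ → ℝ), ∑ T : Finset (Fin k), f T.card =
      ∑ x ∈ Finset.HasAntidiagonal.antidiagonal k, (k.choose x.1 : ℝ) * f x.1 := by
    intro k f
    rw [← Finset.powerset_univ, Finset.sum_powerset_apply_card,
      Finset.Nat.sum_antidiagonal_eq_sum_range_succ_mk]
    simp
  simp only [fun S : Finset (Fin n) => h2 E fun r => connSum g wL w (Fin r) (Fin S.card) *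
    vacSum g w (Fin (E - r)) (Fin (n - S.card))]
  rw [h2 n fun k => ∑ x ∈ Finset.HasAntidiagonal.antidiagonal E, (E.choose x.1 : ℝ) *
    (connSum g wL w (Fin x.1) (Fin k) * vacSum g w (Fin (E - x.1)) (Fin (n - k))), Finset.mul_sum]
  refine Finset.sum_congr rfl fun x hx => ?_
  rw [Finset.mul_sum, Finset.mul_sum]
  refine Finset.sum_congr rfl fun y hy => ?_
  rw [Finset.HasAntidiagonal.mem_antidiagonal] at hx hy
  subst hx hy
  rw [vacSum_congr g w (finCongr (Nat.add_sub_cancel_left y.1 y.2))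
    (finCongr (Nat.add_sub_cancel_left x.1 x.2)), connCoeff, vacCoeff,
    Nat.cast_add_choose, Nat.cast_add_choose, pow_add]
  field_simp

end Sums

end Connected

/-! ### Permutations of ends of edges -/

section Flip

variable {ι ι' : Type*}

/-- The bijection of ends of edges given by a bijection of edges and reversals of edges. -/
def halfEquiv (τ : ι ≃ ι') (s : ι → Bool) : ι × Bool ≃ ι' × Bool where
  toFun h := (τ h.1, xor h.2 (s h.1))
  invFun h := (τ.symm h.1, xor h.2 (s (τ.symm h.1)))
  left_inv h := by simp
  right_inv h := by simp

/-- The image of `(e, false)` determines that of `(e, true)`: its first component gives the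
bijection of edges, its second says whether `e` is reversed. -/
lemma exists_eq_halfEquiv (π : ι × Bool ≃ ι' × Bool)
    (hπ : ∀ e b, π (e, !b) = ((π (e, b)).1, !(π (e, b)).2)) :
    ∃ (τ : ι ≃ ι') (s : ι → Bool), halfEquiv τ s = π := by
  have hinj : Function.Injective fun e => (π (e, false)).1 := by
    intro e e' h
    by_cases h2 : (π (e, false)).2 = (π (e', false)).2
    · exact congrArg Prod.fst (π.injective (Prod.ext h h2))
    · have h3 : π (e, !false) = π (e', false) := by
        rw [hπ]
        refine Prod.ext h ?_
        revert h2
        cases (π (e, false)).2 <;> cases (π (e', false)).2 <;> simp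
      exact congrArg Prod.fst (π.injective h3)
  have hsurj : Function.Surjective fun e => (π (e, false)).1 := by
    intro e'
    obtain ⟨⟨e, b⟩, he⟩ := π.surjective (e', false)
    refine ⟨e, ?_⟩
    cases b
    · exact congrArg Prod.fst he
    · have := congrArg Prod.fst (hπ e true)
      simpa [he] using this
  refine ⟨Equiv.ofBijective _ ⟨hinj, hsurj⟩, fun e => (π (e, false)).2, ?_⟩
  ext1 ⟨e, b⟩
  cases b
  · exact Prod.ext rfl (Bool.false_xor _)
  · have h : π (e, true) = ((π (e, false)).1, !(π (e, false)).2) := hπ e false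
    rw [h]
    exact Prod.ext rfl (Bool.true_xor _)

/-- The bijections of ends of edges that map edges to edges. -/
abbrev FlipPerm (ι : Type*) : Type _ :=
  {π : Equiv.Perm (ι × Bool) // ∀ e b, π (e, !b) = ((π (e, b)).1, !(π (e, b)).2)}

lemma card_flipPerm [Fintype ι] [DecidableEq ι] :
    Nat.card (FlipPerm ι) = (Fintype.card ι)! * 2 ^ Fintype.card ι := by
  have h : Function.Bijective (fun p : Equiv.Perm ι × (ι → Bool) =>
      (⟨halfEquiv p.1 p.2, fun e b => by simp [halfEquiv]⟩ : FlipPerm ι)) := by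
    constructor
    · rintro ⟨τ, s⟩ ⟨τ', s'⟩ hp
      have h1 : ∀ e, (τ e, s e) = (τ' e, s' e) := fun e => by
        simpa [halfEquiv] using DFunLike.congr_fun (congrArg Subtype.val hp) (e, false)
      exact Prod.ext (Equiv.ext fun e => congrArg Prod.fst (h1 e))
        (funext fun e => congrArg Prod.snd (h1 e))
    · rintro ⟨π, hπ⟩
      obtain ⟨τ, s, h⟩ := exists_eq_halfEquiv π hπ
      exact ⟨(τ, s), Subtype.ext h⟩
  rw [← Nat.card_congr (Equiv.ofBijective _ h), Nat.card_prod, Nat.card_eq_fintype_card,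
    Nat.card_eq_fintype_card, Fintype.card_perm, Fintype.card_fun, Fintype.card_bool]

/-- A reversed edge exchanges the two indices of its propagator, which is where symmetry of `g`
enters. -/
lemma graphWeight_congr_flip {d : ℕ} {X X' : Type*} [Fintype ι] [DecidableEq ι] [Fintype ι']
    [DecidableEq ι'] [Fintype X] [DecidableEq X] [Fintype X'] [DecidableEq X']
    {g : Matrix (Fin d) (Fin d) ℝ} (hg : g.IsSymm) (w : X → Multiset (Fin d) → ℝ)
    (w' : X' → Multiset (Fin d) → ℝ) (σ : X ≃ X') (hw : ∀ x, w' (σ x) = w x)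
    (π : ι × Bool ≃ ι' × Bool) (hπ : ∀ e b, π (e, !b) = ((π (e, b)).1, !(π (e, b)).2))
    (a : ι × Bool → X) (a' : ι' × Bool → X') (ha : ∀ h, a' (π h) = σ (a h)) :
    graphWeight g w' a' = graphWeight g w a := by
  rw [graphWeight, graphWeight, ← (π.arrowCongr (Equiv.refl (Fin d))).sum_comp]
  refine Finset.sum_congr rfl fun l _ => ?_
  rw [← σ.prod_comp]
  congr 1
  · refine Finset.prod_congr rfl fun x _ => ?_
    rw [hw, ← starLabels_comp_equiv π, starLabels, starLabels]
    congr 1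
    refine Finset.sum_congr rfl fun h _ => ?_
    simp [ha, Equiv.arrowCongr]
  · obtain ⟨τ, s, rfl⟩ := exists_eq_halfEquiv π hπ
    rw [← τ.prod_comp]
    refine Finset.prod_congr rfl fun e _ => ?_
    cases hs : s e
    · simp [Equiv.arrowCongr, halfEquiv, hs]
    · simpa [Equiv.arrowCongr, halfEquiv, hs] using hg.apply _ _

end Flip

/-! ### Isomorphism classes and orbit-stabilizer counting -/

namespace Graph

variable {m : ℕ}

/-- Composition of isomorphisms. -/
def Iso.trans {G H K : Graph m} (f : Iso G H) (g : Iso H K) : Iso G K where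
  vert := f.vert.trans g.vert
  half := f.half.trans g.half
  half_flip e b := by
    simp only [Equiv.trans_apply]
    rw [f.half_flip, g.half_flip]
  attach_half h := by
    simp only [Equiv.trans_apply]
    rw [g.attach_half, f.attach_half]
    rcases G.attach h with j | v <;> simp

/-- The inverse of an isomorphism. -/
def Iso.symm {G H : Graph m} (f : Iso G H) : Iso H G where
  vert := f.vert.symm
  half := f.half.symm
  half_flip e b := by
    rw [Equiv.symm_apply_eq, f.half_flip]
    simp
  attach_half h := by
    have h1 := f.attach_half (f.half.symm h)
    rw [Equiv.apply_symm_apply] at h1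
    rw [h1]
    rcases G.attach (f.half.symm h) with j | v <;> simp

lemma Iso.ext' {G H : Graph m} {f g : Iso G H} (h1 : f.vert = g.vert) (h2 : f.half = g.half) :
    f = g := by
  cases f; cases g; cases h1; cases h2; rfl

instance {G H : Graph m} : Finite (Iso G H) :=
  Finite.of_injective (fun f : Iso G H => (f.vert, f.half)) fun _ _ h =>
    Iso.ext' (congrArg Prod.fst h) (congrArg Prod.snd h)

lemma card_iso_eq_autCard {G H : Graph m} (f : Iso G H) : Nat.card (Iso G H) = G.autCard :=
  Nat.card_congr
    { toFun := fun k => k.trans f.symm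
      invFun := fun k => k.trans f
      left_inv := fun k => Iso.ext' (by ext; simp [Iso.trans, Iso.symm])
        (by ext1; simp [Iso.trans, Iso.symm])
      right_inv := fun k => Iso.ext' (by ext; simp [Iso.trans, Iso.symm])
        (by ext1; simp [Iso.trans, Iso.symm]) }

lemma autCard_pos (G : Graph m) : 0 < G.autCard := by
  have : Nonempty (Iso G G) := ⟨⟨Equiv.refl _, Equiv.refl _, fun _ _ => rfl, fun h => by
    rw [Equiv.refl_apply]
    rcases G.attach h with j | v <;> rfl⟩⟩
  exact Nat.card_pos

lemma Iso.numInt_eq {G H : Graph m} (f : Iso G H) : G.numInt = H.numInt := by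
  simpa using Fintype.card_congr f.vert

lemma Iso.numEdges_eq {G H : Graph m} (f : Iso G H) : G.numEdges = H.numEdges := by
  have := Fintype.card_congr f.half
  simp only [Fintype.card_prod, Fintype.card_fin, Fintype.card_bool] at this
  omega

lemma toSimple_adj_of_attach (G : Graph m) (e : Fin G.numEdges) (b : Bool)
    (h : G.attach (e, b) ≠ G.attach (e, !b)) :
    G.toSimple.Adj (G.attach (e, b)) (G.attach (e, !b)) := by
  rw [toSimple, SimpleGraph.fromRel_adj]
  refine ⟨h, ?_⟩
  cases b
  · exact Or.inl ⟨e, rfl, rfl⟩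
  · exact Or.inr ⟨e, rfl, rfl⟩

/-- Membership in a closed set propagates along paths, so a path from a leg forces it. -/
lemma nonVacuum_iff (G : Graph m) : G.NonVacuum ↔ LegConnected G.attach := by
  constructor
  · intro H S hS
    have hadj : ∀ x y, G.toSimple.Adj x y → Sum.elim (fun _ => True) (· ∈ S) x →
        Sum.elim (fun _ => True) (· ∈ S) y := by
      intro x y hxy hx
      rw [toSimple, SimpleGraph.fromRel_adj] at hxy
      obtain ⟨-, ⟨e, rfl, rfl⟩ | ⟨e, rfl, rfl⟩⟩ := hxy
      · exact hS e false hx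
      · exact hS e true hx
    have hreach : ∀ x y, G.toSimple.Reachable x y → Sum.elim (fun _ => True) (· ∈ S) x →
        Sum.elim (fun _ => True) (· ∈ S) y := by
      rintro x y ⟨p⟩
      induction p with
      | nil => exact id
      | cons h _ ih => exact fun hx => ih (hadj _ _ h hx)
    ext v
    simp only [Set.mem_univ, iff_true]
    obtain ⟨j, hj⟩ := H (G.toSimple.connectedComponentMk (Sum.inr v))
    exact hreach _ _ (SimpleGraph.ConnectedComponent.exact hj) trivial
  · intro H c
    -- For the converse, the vertices reachable from some leg form a closed set.
    have h1 := H {v | ∃ j : Fin m, G.toSimple.Reachable (Sum.inl j) (Sum.inr v)} ?_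
    · induction c using SimpleGraph.ConnectedComponent.ind with
      | _ x =>
        rcases x with j | v
        · exact ⟨j, rfl⟩
        · have : v ∈ (Set.univ : Set (Fin G.numInt)) := trivial
          rw [← h1] at this
          obtain ⟨j, hj⟩ := this
          exact ⟨j, SimpleGraph.ConnectedComponent.sound hj⟩
    · have key : ∀ x : Fin m ⊕ Fin G.numInt, Sum.elim (fun _ => True)
          (· ∈ {v | ∃ j : Fin m, G.toSimple.Reachable (Sum.inl j) (Sum.inr v)}) x ↔
          ∃ j : Fin m, G.toSimple.Reachable (Sum.inl j) x := by
        rintro (j | v)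
        · simp only [Sum.elim_inl, true_iff]
          exact ⟨j, SimpleGraph.Reachable.refl _⟩
        · rfl
      intro e b
      rw [key, key]
      rintro ⟨j, hj⟩
      refine ⟨j, ?_⟩
      by_cases h : G.attach (e, b) = G.attach (e, !b)
      · rwa [← h]
      · exact hj.trans (G.toSimple_adj_of_attach e b h).reachable

/-- The condition on an attaching map to define a graph without vacuum components. -/
def IsAttach {n E : ℕ} (a : Fin E × Bool → Fin m ⊕ Fin n) : Prop :=
  (∀ j : Fin m, ∃! h, a h = Sum.inl j) ∧
    (∀ v : Fin n, 3 ≤ (Finset.univ.filter fun h => a h = Sum.inr v).card) ∧ LegConnected a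

/-- The attaching maps of graphs without vacuum components. -/
def Attach (m n E : ℕ) : Type := {a : Fin E × Bool → Fin m ⊕ Fin n // IsAttach a}

instance {n E : ℕ} : Finite (Attach m n E) := Subtype.finite

instance {n E : ℕ} : Fintype (Attach m n E) := Fintype.ofFinite _

/-- The graph of an attaching map. -/
def Attach.graph {n E : ℕ} (a : Attach m n E) : Graph m where
  numInt := n
  numEdges := E
  attach := a.1
  leg_univalent := a.2.1
  three_le_valence := a.2.2.1

lemma Attach.nonVacuum {n E : ℕ} (a : Attach m n E) : a.graph.NonVacuum :=
  (nonVacuum_iff _).2 a.2.2.2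

/-- The isomorphism class of the graph of an attaching map. -/
def Attach.toClass {n E : ℕ} (a : Attach m n E) : NonVacuumClass m :=
  Quotient.mk (isoSetoid m) ⟨a.graph, a.nonVacuum⟩

lemma NonVacuumClass.rep_nonVacuum (c : NonVacuumClass m) : c.rep.NonVacuum := (Quotient.out c).2

lemma Attach.toClass_eq_iff {n E : ℕ} (a : Attach m n E) (c : NonVacuumClass m) :
    a.toClass = c ↔ Nonempty (Iso c.rep a.graph) := by
  rw [eq_comm]
  conv_lhs => rw [← Quotient.out_eq c]
  exact Quotient.eq

lemma isAttach_map {n E : ℕ} {a : Fin E × Bool → Fin m ⊕ Fin n} (ha : IsAttach a)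
    (σ : Equiv.Perm (Fin n)) (π : FlipPerm (Fin E)) :
    IsAttach fun h => Sum.map id σ (a (π.1.symm h)) := by
  obtain ⟨h1, h2, h3⟩ := ha
  have hl : ∀ (x : Fin m ⊕ Fin n) j, Sum.map id σ x = Sum.inl j ↔ x = Sum.inl j := by
    rintro (x | x) j <;> simp
  have hr : ∀ (x : Fin m ⊕ Fin n) v, Sum.map id σ x = Sum.inr v ↔ x = Sum.inr (σ.symm v) := by
    rintro (x | x) j <;> simp [Equiv.eq_symm_apply]
  refine ⟨fun j => ?_, fun v => ?_, ?_⟩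
  · simp only [hl]
    obtain ⟨h, hh, hu⟩ := h1 j
    refine ⟨π.1 h, by simpa using hh, fun y hy => ?_⟩
    rw [← hu _ hy, Equiv.apply_symm_apply]
  · simp only [hr]
    refine (h2 (σ.symm v)).trans (le_of_eq (Finset.card_equiv π.1 fun h => ?_))
    simp
  · intro S hS
    have := h3 (σ ⁻¹' S) ?_
    · rw [← Set.preimage_eq_preimage σ.surjective, this, Set.preimage_univ]
    · have key : ∀ h, Sum.elim (fun _ => True) (· ∈ S) (Sum.map id σ (a (π.1.symm h))) ↔
          Sum.elim (fun _ => True) (· ∈ σ ⁻¹' S) (a (π.1.symm h)) := by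
        intro h
        rcases a (π.1.symm h) with j | v <;> rfl
      intro e b h
      have h4 := hS (π.1 (e, b)).1 (π.1 (e, b)).2
      rw [key, key, ← π.2 e b, Equiv.symm_apply_apply, Equiv.symm_apply_apply] at h4
      exact h4 h

open Classical in
/-- The number of attaching maps in an isomorphism class, by the orbit-stabilizer relation. -/
lemma card_toClass_mul_autCard (c : NonVacuumClass m) :
    (Finset.univ.filter fun a : Attach m c.rep.numInt c.rep.numEdges => a.toClass = c).card *
      c.rep.autCard = (c.rep.numInt)! * ((c.rep.numEdges)! * 2 ^ c.rep.numEdges) := by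
  set n := c.rep.numInt
  set E := c.rep.numEdges
  let T := {a : Attach m n E // a.toClass = c}
  -- An isomorphism out of `c.rep` determines its target as the transported attaching map, and every
  -- group element arises in this way. Each fibre over `a` has `|Aut|` elements, so comparing
  -- cardinalities gives the count.
  let F : (Σ a : T, Iso c.rep a.1.graph) → Equiv.Perm (Fin n) × FlipPerm (Fin E) :=
    fun p => (p.2.vert, ⟨p.2.half, p.2.half_flip⟩)
  have hF : Function.Bijective F := by
    constructor
    · rintro ⟨⟨a, ha⟩, f⟩ ⟨⟨a', ha'⟩, f'⟩ h
      have h1 : f.vert = f'.vert := congrArg Prod.fst h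
      have h2 : f.half = f'.half := congrArg Subtype.val (congrArg Prod.snd h)
      have h3 : a = a' := by
        refine Subtype.ext (funext fun x => ?_)
        obtain ⟨y, rfl⟩ := f.half.surjective x
        have e1 := f.attach_half y
        have e2 := f'.attach_half y
        rw [← h1, ← h2] at e2
        exact e1.trans e2.symm
      subst h3
      have h4 : f = f' := Iso.ext' h1 h2
      subst h4
      rfl
    · rintro ⟨σ, π⟩
      have hc : IsAttach c.rep.attach :=
        ⟨c.rep.leg_univalent, c.rep.three_le_valence, (nonVacuum_iff _).1 c.rep_nonVacuum⟩
      let a : Attach m n E := ⟨_, isAttach_map hc σ π⟩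
      let f : Iso c.rep a.graph :=
        { vert := σ
          half := π.1
          half_flip := π.2
          attach_half := fun h => by
            change Sum.map id σ (c.rep.attach (π.1.symm (π.1 h))) = _
            rw [Equiv.symm_apply_apply]
            rfl }
      exact ⟨⟨⟨a, (a.toClass_eq_iff c).2 ⟨f⟩⟩, f⟩, rfl⟩
  have h1 := Nat.card_congr (Equiv.ofBijective F hF)
  rw [Nat.card_sigma, Nat.card_prod, card_flipPerm, Nat.card_eq_fintype_card, Fintype.card_perm,
    Fintype.card_fin, Fintype.card_fin] at h1
  rw [← h1, Finset.sum_congr rfl fun (a : T) _ =>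
    card_iso_eq_autCard ((a.1.toClass_eq_iff c).1 a.2).some, Finset.sum_const, smul_eq_mul,
    Finset.card_univ, Fintype.card_subtype]

open Classical in
/-- The isomorphism classes of graphs with `n` internal vertices and `E` edges. -/
def classes (m n E : ℕ) : Finset (NonVacuumClass m) :=
  Finset.univ.image fun a : Attach m n E => a.toClass

lemma mem_classes {n E : ℕ} {c : NonVacuumClass m} :
    c ∈ classes m n E ↔ c.rep.numInt = n ∧ c.rep.numEdges = E := by
  simp only [classes, Finset.mem_image, Finset.mem_univ, true_and]
  constructor
  · rintro ⟨a, ha⟩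
    obtain ⟨f⟩ := (a.toClass_eq_iff c).1 ha
    exact ⟨f.numInt_eq, f.numEdges_eq⟩
  · rintro ⟨rfl, rfl⟩
    let a : Attach m c.rep.numInt c.rep.numEdges :=
      ⟨c.rep.attach, c.rep.leg_univalent, c.rep.three_le_valence,
        (nonVacuum_iff _).1 c.rep_nonVacuum⟩
    refine ⟨a, ?_⟩
    change Quotient.mk (isoSetoid m) (Quotient.out c) = c
    exact Quotient.out_eq c

/-- Sums over attaching maps of an isomorphism invariant are sums over isomorphism classes. -/
lemma sum_attach_eq_sum_classes (n E : ℕ) (f : Graph m → ℝ)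
    (hf : ∀ G H : Graph m, Nonempty (Iso G H) → f G = f H) :
    ((n ! : ℝ) * ((E ! : ℝ) * 2 ^ E))⁻¹ * ∑ a : Attach m n E, f a.graph =
      ∑ c ∈ classes m n E, (1 / (c.rep.autCard : ℝ)) * f c.rep := by
  classical
  rw [← Finset.sum_fiberwise_of_maps_to (s := Finset.univ) (t := classes m n E)
    (g := fun a : Attach m n E => a.toClass) fun a _ =>
      Finset.mem_image_of_mem _ (Finset.mem_univ a), Finset.mul_sum]
  refine Finset.sum_congr rfl fun c hc => ?_
  obtain ⟨rfl, rfl⟩ := mem_classes.1 hc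
  rw [Finset.sum_congr rfl fun a ha =>
    (hf _ _ ((Attach.toClass_eq_iff a c).1 (Finset.mem_filter.1 ha).2)).symm, Finset.sum_const,
    nsmul_eq_mul]
  have h1 := congrArg (Nat.cast (R := ℝ)) (card_toClass_mul_autCard c)
  push_cast at h1
  have h2 : (c.rep.autCard : ℝ) ≠ 0 := Nat.cast_ne_zero.2 (autCard_pos _).ne'
  rw [← h1]
  have h3 : ((Finset.univ.filter fun a : Attach m c.rep.numInt c.rep.numEdges =>
      a.toClass = c).card : ℝ) ≠ 0 := by
    intro h
    rw [h, zero_mul] at h1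
    exact (by positivity : (0 : ℝ) < (c.rep.numInt)! * ((c.rep.numEdges)! *
      2 ^ c.rep.numEdges)).ne h1
  field_simp

end Graph

/-! ### Valence constraints from nonzero weights -/

section Valence

variable {d : ℕ} {H ι X : Type*} [Fintype H] [DecidableEq X]

lemma card_starLabels {D : Type*} (a : H → X) (l : H → D) (x : X) :
    (starLabels a l x).card = (Finset.univ.filter fun h => a h = x).card := by
  rw [starLabels_eq_map, Multiset.card_map]
  rfl

variable [Fintype ι] [DecidableEq ι] [Fintype X]

lemma sum_card_starLabels {D : Type*} (a : H → X) (l : H → D) :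
    ∑ x, (starLabels a l x).card = Fintype.card H := by
  simp only [card_starLabels]
  exact (Finset.card_eq_sum_card_fiberwise fun _ _ => Finset.mem_univ _).symm

lemma exists_labels_of_graphWeight_ne_zero {g : Matrix (Fin d) (Fin d) ℝ}
    {w : X → Multiset (Fin d) → ℝ} {a : ι × Bool → X} (h : graphWeight g w a ≠ 0) :
    ∃ l : ι × Bool → Fin d, ∀ x, w x (starLabels a l x) ≠ 0 := by
  obtain ⟨l, -, hl⟩ := Finset.exists_ne_zero_of_sum_ne_zero h
  exact ⟨l, fun x => Finset.prod_ne_zero_iff.1 (left_ne_zero_of_mul hl) x (Finset.mem_univ x)⟩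

lemma card_of_vertexFactor_X_ne_zero {i : Fin d} {s : Multiset (Fin d)}
    (h : vertexFactor (MvPowerSeries.X i) s ≠ 0) : s.card = 1 := by
  rw [vertexFactor_X] at h
  have : s = {i} := by
    by_contra h1
    exact h (if_neg h1)
  rw [this, Multiset.card_singleton]

lemma degree_toFinsupp (s : Multiset (Fin d)) : (Multiset.toFinsupp s).degree = s.card := by
  rw [← Multiset.toFinsupp_sum_eq]
  rfl

/-- Valence `0` must be allowed, since `U` may have a constant term; such a vertex is a vacuum
component. -/
lemma card_of_vertexFactor_ne_zero {U : MvPowerSeries (Fin d) ℝ} (hU : NoLowTerms U)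
    {s : Multiset (Fin d)} (h : vertexFactor U s ≠ 0) : s.card = 0 ∨ 3 ≤ s.card := by
  by_contra! h1
  refine right_ne_zero_of_mul h (hU _ ?_)
  rw [degree_toFinsupp]
  omega

lemma card_le_of_vertexFactor_coe_ne_zero {U : MvPolynomial (Fin d) ℝ} {s : Multiset (Fin d)}
    (h : vertexFactor (U : MvPowerSeries (Fin d) ℝ) s ≠ 0) : s.card ≤ U.totalDegree := by
  rw [← degree_toFinsupp]
  refine MvPolynomial.le_totalDegree (MvPolynomial.mem_support_iff.2 ?_)
  have := right_ne_zero_of_mul h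
  rwa [MvPolynomial.coeff_coe] at this

end Valence

/-! ### Attaching-map sums as sums over isomorphism classes -/

section LabelSum

variable {d m : ℕ}

/-- The vertex functions of legs with the labels `i j`. -/
def legFactor (i : Fin m → Fin d) (j : Fin m) : Multiset (Fin d) → ℝ :=
  vertexFactor (MvPowerSeries.X (i j))

/-- Legs are treated as vertices with potential `X (i j)`: at a univalent leg this factor is `1` or
`0` according to whether the label is `i j`. -/
lemma labelSum_eq_graphWeight (A : Matrix (Fin d) (Fin d) ℝ) (U : MvPowerSeries (Fin d) ℝ)
    (i : Fin m → Fin d) (G : Graph m) :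
    labelSum A U i G =
      graphWeight A⁻¹ (Sum.elim (legFactor i) fun _ => vertexFactor U) G.attach := by
  classical
  rw [labelSum, graphWeight, Finset.sum_filter]
  refine Finset.sum_congr rfl fun l _ => ?_
  rw [Fintype.prod_sum_type]
  simp only [Sum.elim_inl, Sum.elim_inr]
  have h1 : ∏ j, legFactor i j (starLabels G.attach l (Sum.inl j)) =
      if ∀ h j, G.attach h = Sum.inl j → l h = i j then 1 else 0 := by
    have h2 : ∀ j, legFactor i j (starLabels G.attach l (Sum.inl j)) =
        if ∀ h, G.attach h = Sum.inl j → l h = i j then 1 else 0 := by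
      intro j
      obtain ⟨h, hh, hu⟩ := G.leg_univalent j
      have h3 : (Finset.univ.filter fun h => G.attach h = Sum.inl j) = {h} := by
        ext h'
        simp only [Finset.mem_filter, Finset.mem_univ, true_and, Finset.mem_singleton]
        exact ⟨hu h', fun e => e ▸ hh⟩
      rw [legFactor, vertexFactor_X, starLabels_eq_map, h3]
      simp only [Finset.singleton_val, Multiset.map_singleton, Multiset.singleton_inj]
      refine if_congr ⟨fun e h' hh' => by rw [hu h' hh', e], fun e => e h hh⟩ rfl rfl
    simp only [h2]
    split_ifs with hc
    · exact Finset.prod_eq_one fun j _ => if_pos fun h => hc h j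
    · push Not at hc
      obtain ⟨h, j, h5, h6⟩ := hc
      exact Finset.prod_eq_zero (Finset.mem_univ j) (if_neg fun h7 => h6 (h7 h h5))
  have h4 : ∀ v, (G.star v).val.map l = starLabels G.attach l (Sum.inr v) :=
    fun v => (starLabels_eq_map _ _ _).symm
  rw [h1]
  simp only [h4]
  split_ifs <;> simp

lemma labelSum_congr {A : Matrix (Fin d) (Fin d) ℝ} (hA : (A⁻¹).IsSymm)
    (U : MvPowerSeries (Fin d) ℝ) (i : Fin m → Fin d) (G H : Graph m)
    (h : Nonempty (Graph.Iso G H)) : labelSum A U i G = labelSum A U i H := by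
  obtain ⟨f⟩ := h
  rw [labelSum_eq_graphWeight, labelSum_eq_graphWeight]
  refine (graphWeight_congr_flip hA _ _ ((Equiv.refl _).sumCongr f.vert) ?_ f.half f.half_flip _ _
    f.attach_half).symm
  rintro (j | v) <;> rfl

/-- The valence conditions on graphs need not be imposed in `connSum`: maps violating them have
weight zero. -/
lemma isAttach_of_graphWeight_ne_zero {g : Matrix (Fin d) (Fin d) ℝ}
    {U : MvPowerSeries (Fin d) ℝ} (hU : NoLowTerms U) {i : Fin m → Fin d} {n E : ℕ}
    {a : Fin E × Bool → Fin m ⊕ Fin n} (ha : LegConnected a)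
    (h : graphWeight g (Sum.elim (legFactor i) fun _ => vertexFactor U) a ≠ 0) :
    Graph.IsAttach a := by
  obtain ⟨l, hl⟩ := exists_labels_of_graphWeight_ne_zero h
  refine ⟨fun j => ?_, fun v => ?_, ha⟩
  · have h1 := card_of_vertexFactor_X_ne_zero (hl (Sum.inl j))
    rw [card_starLabels, Finset.card_eq_one] at h1
    obtain ⟨h, hh⟩ := h1
    refine ⟨h, ?_, fun h' hh' => ?_⟩
    · have : h ∈ Finset.univ.filter fun h => a h = Sum.inl j := hh ▸ Finset.mem_singleton_self h
      exact (Finset.mem_filter.1 this).2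
    · have : h' ∈ Finset.univ.filter fun h => a h = Sum.inl j :=
        Finset.mem_filter.2 ⟨Finset.mem_univ _, hh'⟩
      rw [hh] at this
      exact Finset.mem_singleton.1 this
  · rcases card_of_vertexFactor_ne_zero hU (hl (Sum.inr v)) with h1 | h1
    · exfalso
      rw [card_starLabels, Finset.card_eq_zero, Finset.filter_eq_empty_iff] at h1
      -- If no end is attached to `v`, the complement of `v` is closed, against leg-connectedness.
      have h2 := ha {v}ᶜ fun e b _ => by
        have := h1 (Finset.mem_univ (e, !b))
        rcases hx : a (e, !b) with j | u
        · trivial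
        · rw [hx] at this
          exact fun hu => this (congrArg Sum.inr hu)
      have h3 : v ∈ ({v}ᶜ : Set (Fin n)) := h2 ▸ Set.mem_univ v
      exact h3 rfl
    · rwa [card_starLabels] at h1

/-- The normalized sum over attaching maps is a sum over isomorphism classes. -/
lemma connCoeff_eq_sum_classes {A : Matrix (Fin d) (Fin d) ℝ} (hA : (A⁻¹).IsSymm)
    {U : MvPowerSeries (Fin d) ℝ} (hU : NoLowTerms U) (i : Fin m → Fin d) (n E : ℕ) :
    connCoeff A⁻¹ (legFactor i) (vertexFactor U) n E =
      ∑ c ∈ Graph.classes m n E, (1 / (c.rep.autCard : ℝ)) * labelSum A U i c.rep := by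
  classical
  rw [← Graph.sum_attach_eq_sum_classes n E _ (labelSum_congr hA U i), connCoeff, connSum]
  congr 1
  simp only [labelSum_eq_graphWeight]
  symm
  refine Finset.sum_of_injOn Subtype.val Subtype.val_injective.injOn ?_ ?_ ?_
  · intro a _
    simpa using a.2.2.2
  · intro a ha h
    by_contra h0
    exact h ⟨⟨a, isAttach_of_graphWeight_ne_zero hU (by simpa using ha) h0⟩,
      Finset.mem_coe.2 (Finset.mem_univ _), rfl⟩
  · intro a _
    rfl

lemma Graph.totalValence_add (G : Graph m) : G.totalValence + m = 2 * G.numEdges := by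
  have h := sum_card_starLabels G.attach (fun h => h)
  rw [Fintype.sum_sum_type, Fintype.card_prod, Fintype.card_fin, Fintype.card_bool] at h
  simp only [card_starLabels] at h
  have h1 : ∀ j : Fin m, (Finset.univ.filter fun h => G.attach h = Sum.inl j).card = 1 := by
    intro j
    obtain ⟨h, hh, hu⟩ := G.leg_univalent j
    rw [Finset.card_eq_one]
    refine ⟨h, ?_⟩
    ext h'
    simp only [Finset.mem_filter, Finset.mem_univ, true_and, Finset.mem_singleton]
    exact ⟨hu h', fun e => e ▸ hh⟩
  simp only [h1, Finset.sum_const, Finset.card_univ, Fintype.card_fin, smul_eq_mul, mul_one] at h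
  rw [mul_comm 2, ← h, add_comm]
  rfl

/-- A nonzero term has every leg of valence `1` and every internal vertex of valence at most the
degree of `U`; this bounds the number `2E` of ends. -/
lemma labelSum_eq_zero_of_lt (A : Matrix (Fin d) (Fin d) ℝ) (U : MvPolynomial (Fin d) ℝ)
    (i : Fin m → Fin d) (G : Graph m) (h : m + G.numInt * U.totalDegree < 2 * G.numEdges) :
    labelSum A (U : MvPowerSeries (Fin d) ℝ) i G = 0 := by
  rw [labelSum_eq_graphWeight]
  by_contra h0
  obtain ⟨l, hl⟩ := exists_labels_of_graphWeight_ne_zero h0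
  have h1 := sum_card_starLabels G.attach l
  rw [Fintype.sum_sum_type, Fintype.card_prod, Fintype.card_fin, Fintype.card_bool] at h1
  have h2 : ∑ j : Fin m, (starLabels G.attach l (Sum.inl j)).card = m := by
    rw [Finset.sum_congr rfl fun j _ => card_of_vertexFactor_X_ne_zero (hl (Sum.inl j))]
    simp
  have h3 : ∑ v, (starLabels G.attach l (Sum.inr v)).card ≤ G.numInt * U.totalDegree := by
    refine (Finset.sum_le_sum fun v _ =>
      card_le_of_vertexFactor_coe_ne_zero (hl (Sum.inr v))).trans ?_
    simp
  omega

lemma connCoeff_eq_zero_of_lt (g : Matrix (Fin d) (Fin d) ℝ) (w : Multiset (Fin d) → ℝ)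
    (i : Fin m → Fin d) {n E : ℕ} (h : 2 * E < m) : connCoeff g (legFactor i) w n E = 0 := by
  classical
  rw [connCoeff, connSum, Finset.sum_eq_zero, mul_zero]
  intro a _
  by_contra h0
  obtain ⟨l, hl⟩ := exists_labels_of_graphWeight_ne_zero h0
  have h1 := sum_card_starLabels a l
  rw [Fintype.sum_sum_type, Fintype.card_prod, Fintype.card_fin, Fintype.card_bool] at h1
  have h2 : ∑ j : Fin m, (starLabels a l (Sum.inl j)).card = m := by
    rw [Finset.sum_congr rfl fun j _ => card_of_vertexFactor_X_ne_zero (hl (Sum.inl j))]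
    simp
  omega

end LabelSum

/-! ### Formal power series and Cauchy products -/

section Formal

variable {d : ℕ} {σ : Type*}

/-- In both applications the exponent of `ħ` in `e` singles out one power of `V`, so the exponential
series collapses to one term. -/
lemma coeff_expSeries {V : MvPowerSeries σ (MvPolynomial (Fin d) ℝ)}
    (hV : MvPowerSeries.constantCoeff V = 0) (e : σ →₀ ℕ) (n : ℕ)
    (h : ∀ k, k ≠ n → MvPowerSeries.coeff e (V ^ k) = 0) :
    MvPowerSeries.coeff e (expSeries V) = (n ! : ℝ)⁻¹ • MvPowerSeries.coeff e (V ^ n) := by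
  rw [expSeries, PowerSeries.coeff_subst (PowerSeries.HasSubst.of_constantCoeff_zero hV),
    finsum_eq_single _ n fun k hk => by rw [h k hk, smul_zero], PowerSeries.coeff_exp]
  simp

lemma coeff_perturbedInt {V : MvPowerSeries σ (MvPolynomial (Fin d) ℝ)}
    (hV : MvPowerSeries.constantCoeff V = 0) (A : Matrix (Fin d) (Fin d) ℝ)
    (p : MvPolynomial (Fin d) ℝ) (e : σ →₀ ℕ) (n : ℕ)
    (h : ∀ k, k ≠ n → MvPowerSeries.coeff e (V ^ k) = 0) :
    MvPowerSeries.coeff e (perturbedInt A V p) =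
      (n ! : ℝ)⁻¹ * gaussInt A (MvPowerSeries.coeff e (V ^ n) * p) := by
  change gaussInt A (MvPowerSeries.coeff e (expSeries V * MvPowerSeries.C p)) = _
  rw [MvPowerSeries.coeff_mul_C, coeff_expSeries hV e n h, smul_mul_assoc, gaussInt_smul]

lemma constantCoeff_perturbedInt_ne_zero {A : Matrix (Fin d) (Fin d) ℝ} (hA : A.PosDef)
    {V : MvPowerSeries σ (MvPolynomial (Fin d) ℝ)} (hV : MvPowerSeries.constantCoeff V = 0) :
    MvPowerSeries.constantCoeff (perturbedInt A V 1) ≠ 0 := by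
  rw [← MvPowerSeries.coeff_zero_eq_constantCoeff_apply, coeff_perturbedInt hV A 1 0 0]
  · simpa using (gaussInt_one_pos hA).ne'
  · intro k hk
    rw [MvPowerSeries.coeff_zero_eq_constantCoeff_apply, map_pow, hV, zero_pow hk]

/-- Reduces the theorem to a product identity with the partition function. -/
lemma correlator_eq_of_mul_eq {m : ℕ} {A : Matrix (Fin d) (Fin d) ℝ} (hA : A.PosDef)
    {V : MvPowerSeries σ (MvPolynomial (Fin d) ℝ)} (hV : MvPowerSeries.constantCoeff V = 0)
    (f : Fin m → MvPolynomial (Fin d) ℝ) (S : MvPowerSeries σ ℝ)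
    (h : S * perturbedInt A V 1 = perturbedInt A V (∏ j, f j)) :
    correlator A V f = S :=
  ((MvPowerSeries.eq_mul_inv_iff_mul_eq (constantCoeff_perturbedInt_ne_zero hA hV)).2 h).symm

lemma eq_single_fin_one_iff (e : Fin 1 →₀ ℕ) (n : ℕ) : e = Finsupp.single 0 n ↔ e 0 = n := by
  refine ⟨fun h => by simp [h], fun h => Finsupp.ext fun j => ?_⟩
  rw [Subsingleton.elim j 0, Finsupp.single_eq_same, h]

lemma sum_antidiagonal_fin_one {R : Type*} [AddCommMonoid R] (e : Fin 1 →₀ ℕ) (F : ℕ → ℕ → R) :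
    ∑ p ∈ Finset.HasAntidiagonal.antidiagonal e, F (p.1 0) (p.2 0) =
      ∑ x ∈ Finset.HasAntidiagonal.antidiagonal (e 0), F x.1 x.2 := by
  conv_lhs => rw [(eq_single_fin_one_iff e _).2 rfl, Finsupp.antidiagonal_single, Finset.sum_map]
  simp

/-- The exponent `(a, b)`. -/
def pairExp (a b : ℕ) : Fin 2 →₀ ℕ := Finsupp.single 0 a + Finsupp.single 1 b

@[simp] lemma pairExp_zero (a b : ℕ) : pairExp a b 0 = a := by simp [pairExp]

@[simp] lemma pairExp_one (a b : ℕ) : pairExp a b 1 = b := by simp [pairExp]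

lemma pairExp_ext {e f : Fin 2 →₀ ℕ} (h0 : e 0 = f 0) (h1 : e 1 = f 1) : e = f := by
  ext j
  fin_cases j
  · exact h0
  · exact h1

lemma sum_antidiagonal_fin_two {R : Type*} [AddCommMonoid R] (e : Fin 2 →₀ ℕ)
    (F : ℕ → ℕ → ℕ → ℕ → R) :
    ∑ p ∈ Finset.HasAntidiagonal.antidiagonal e, F (p.1 0) (p.2 0) (p.1 1) (p.2 1) =
      ∑ x ∈ Finset.HasAntidiagonal.antidiagonal (e 0),
        ∑ y ∈ Finset.HasAntidiagonal.antidiagonal (e 1), F x.1 x.2 y.1 y.2 := by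
  rw [← Finset.sum_product']
  refine Finset.sum_nbij' (fun p => ((p.1 0, p.2 0), (p.1 1, p.2 1)))
    (fun q => (pairExp q.1.1 q.2.1, pairExp q.1.2 q.2.2)) ?_ ?_ ?_ ?_ ?_
  · rintro ⟨a, b⟩ h
    rw [Finset.HasAntidiagonal.mem_antidiagonal] at h
    simp [← h]
  · rintro ⟨⟨a, b⟩, ⟨c, f⟩⟩ h
    simp only [Finset.mem_product, Finset.HasAntidiagonal.mem_antidiagonal] at h ⊢
    exact pairExp_ext (by simpa using h.1) (by simpa using h.2)
  · rintro ⟨a, b⟩ _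
    exact Prod.ext (pairExp_ext (by simp) (by simp)) (pairExp_ext (by simp) (by simp))
  · rintro ⟨⟨a, b⟩, ⟨c, f⟩⟩ _
    simp
  · intro _ _
    rfl

/-- The Cauchy product in the number of edges; convergent unconditional sums of reals are absolutely
convergent. -/
lemma hasSum_sum_antidiagonal {f g : ℕ → ℝ} {a b : ℝ} (hf : HasSum f a) (hg : HasSum g b) :
    HasSum (fun E => ∑ y ∈ Finset.HasAntidiagonal.antidiagonal E, f y.1 * g y.2) (a * b) := by
  have h1 := tsum_mul_tsum_eq_tsum_sum_antidiagonal_of_summable_norm hf.summable.norm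
    hg.summable.norm
  have h2 := (summable_norm_sum_mul_antidiagonal_of_summable_norm hf.summable.norm
    hg.summable.norm).of_norm.hasSum
  rwa [← h1, hf.tsum_eq, hg.tsum_eq] at h2

end Formal

/-! ### Gaussian integrals as sums over attaching maps -/

section Gaussian

variable {d : ℕ} {A : Matrix (Fin d) (Fin d) ℝ} {X : Type*} [Fintype X] [DecidableEq X]

/-- Gaussian integrals of products as sums over graphs. -/
lemma hasSum_gaussInt_graphWeight (hA : A.PosDef) (p : MvPolynomial (Fin d) ℝ)
    (P : X → MvPowerSeries (Fin d) ℝ) (hp : (p : MvPowerSeries (Fin d) ℝ) = ∏ x, P x) :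
    HasSum (fun E : ℕ => gaussInt A 1 * (((E ! : ℝ) * 2 ^ E)⁻¹ *
      ∑ a : Fin E × Bool → X, graphWeight A⁻¹ (fun x => vertexFactor (P x)) a))
      (gaussInt A p) := by
  convert! hasSum_gaussInt hA p using 5 with E
  exact (constantCoeff_laplace_pow_prod _ E p P fun s _ => by rw [hp]).symm

/-- Gaussian integrals of homogeneous components of products as sums over graphs. -/
lemma hasSum_gaussInt_graphWeight_of_degree (hA : A.PosDef) (p : MvPolynomial (Fin d) ℝ)
    (P : X → MvPowerSeries (Fin d) ℝ) (N : ℕ)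
    (hp : ∀ s, vertexFactor (p : MvPowerSeries (Fin d) ℝ) s =
      if s.card = N then vertexFactor (∏ x, P x) s else 0) :
    HasSum (fun E : ℕ => gaussInt A 1 * (((E ! : ℝ) * 2 ^ E)⁻¹ * if 2 * E = N then
      ∑ a : Fin E × Bool → X, graphWeight A⁻¹ (fun x => vertexFactor (P x)) a else 0))
      (gaussInt A p) := by
  convert! hasSum_gaussInt hA p using 5 with E
  split_ifs with h
  · exact (constantCoeff_laplace_pow_prod _ E p P fun s hs => by
      rw [hp, if_pos (hs.trans h)]).symm
  · rw [constantCoeff_laplace_pow, Finset.sum_eq_zero]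
    intro l _
    rw [hp, if_neg, zero_mul]
    simpa [mul_comm] using h

end Gaussian

/-! ### Polynomial potentials -/

section Polynomial

variable {d m : ℕ} {A : Matrix (Fin d) (Fin d) ℝ}

/-- The factors of the integrand `x^{i_1} ⋯ x^{i_m} U^n`. -/
def integrandFactor (i : Fin m → Fin d) (U : MvPowerSeries (Fin d) ℝ) (n : ℕ) :
    Fin m ⊕ Fin n → MvPowerSeries (Fin d) ℝ :=
  Sum.elim (fun j => MvPowerSeries.X (i j)) fun _ => U

lemma vertexFactor_integrandFactor (i : Fin m → Fin d) (U : MvPowerSeries (Fin d) ℝ) (n : ℕ) :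
    (fun x => vertexFactor (integrandFactor i U n x)) =
      Sum.elim (legFactor i) fun _ => vertexFactor U := by
  ext (j | v) <;> rfl

lemma prod_integrandFactor (i : Fin m → Fin d) (U : MvPowerSeries (Fin d) ℝ) (n : ℕ) :
    ∏ x, integrandFactor i U n x = U ^ n * ∏ j, MvPowerSeries.X (i j) := by
  rw [Fintype.prod_sum_type, mul_comm]
  simp [integrandFactor]

lemma coe_prod_X (i : Fin m → Fin d) :
    ((∏ j, MvPolynomial.X (i j) : MvPolynomial (Fin d) ℝ) : MvPowerSeries (Fin d) ℝ) =
      ∏ j, MvPowerSeries.X (i j) := by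
  rw [← MvPolynomial.coeToMvPowerSeries.ringHom_apply, map_prod]
  simp

lemma hbarPotential_pow (U : MvPolynomial (Fin d) ℝ) (n : ℕ) :
    hbarPotential U ^ n = MvPowerSeries.X 0 ^ n * MvPowerSeries.C (U ^ n) := by
  rw [hbarPotential, mul_pow, map_pow]

lemma coeff_hbarPotential_pow (U : MvPolynomial (Fin d) ℝ) (e : Fin 1 →₀ ℕ) (n : ℕ) :
    MvPowerSeries.coeff e (hbarPotential U ^ n) = if n = e 0 then U ^ n else 0 := by
  rw [hbarPotential_pow, MvPowerSeries.coeff_mul_C, MvPowerSeries.coeff_X_pow, ite_mul, one_mul,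
    zero_mul]
  exact if_congr ((eq_single_fin_one_iff e n).trans eq_comm) rfl rfl

lemma constantCoeff_hbarPotential (U : MvPolynomial (Fin d) ℝ) :
    MvPowerSeries.constantCoeff (hbarPotential U) = 0 := by
  simp [hbarPotential]

lemma hasSum_coeff_perturbedInt_hbar (hA : A.PosDef) (U : MvPolynomial (Fin d) ℝ)
    (i : Fin m → Fin d) (e : Fin 1 →₀ ℕ) :
    HasSum (fun E : ℕ => gaussInt A 1 * ∑ x ∈ Finset.HasAntidiagonal.antidiagonal (e 0),
      ∑ y ∈ Finset.HasAntidiagonal.antidiagonal E,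
        connCoeff A⁻¹ (legFactor i) (vertexFactor (U : MvPowerSeries (Fin d) ℝ)) x.1 y.1 *
          vacCoeff A⁻¹ (vertexFactor (U : MvPowerSeries (Fin d) ℝ)) x.2 y.2)
      (MvPowerSeries.coeff e (perturbedInt A (hbarPotential U) (∏ j, MvPolynomial.X (i j)))) := by
  rw [coeff_perturbedInt (constantCoeff_hbarPotential U) A _ e (e 0) fun k hk => by
    rw [coeff_hbarPotential_pow, if_neg hk], coeff_hbarPotential_pow, if_pos rfl]
  have h := (hasSum_gaussInt_graphWeight hA (U ^ e 0 * ∏ j, MvPolynomial.X (i j))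
    (integrandFactor i (U : MvPowerSeries (Fin d) ℝ) (e 0)) (by
      rw [prod_integrandFactor, MvPolynomial.coe_mul, MvPolynomial.coe_pow, coe_prod_X])).mul_left
    ((e 0)! : ℝ)⁻¹
  convert! h using 2 with E
  rw [vertexFactor_integrandFactor, ← sum_graphWeight_eq, mul_inv]
  ring

lemma hasSum_coeff_partition_hbar (hA : A.PosDef) (U : MvPolynomial (Fin d) ℝ)
    (e : Fin 1 →₀ ℕ) :
    HasSum (fun E : ℕ => gaussInt A 1 *
      vacCoeff A⁻¹ (vertexFactor (U : MvPowerSeries (Fin d) ℝ)) (e 0) E)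
      (MvPowerSeries.coeff e (perturbedInt A (hbarPotential U) 1)) := by
  rw [coeff_perturbedInt (constantCoeff_hbarPotential U) A _ e (e 0) fun k hk => by
    rw [coeff_hbarPotential_pow, if_neg hk], coeff_hbarPotential_pow, if_pos rfl]
  have h := (hasSum_gaussInt_graphWeight hA (U ^ e 0 * 1)
    (fun _ : Fin (e 0) => (U : MvPowerSeries (Fin d) ℝ)) (by simp)).mul_left ((e 0)! : ℝ)⁻¹
  convert! h using 2 with E
  rw [vacCoeff, vacSum, mul_inv]
  ring

lemma connCoeff_eq_zero_of_totalDegree_lt (hA : A.PosDef) {U : MvPolynomial (Fin d) ℝ}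
    (hU : NoLowTerms (U : MvPowerSeries (Fin d) ℝ)) (i : Fin m → Fin d) {n E : ℕ}
    (h : m + n * U.totalDegree < 2 * E) :
    connCoeff A⁻¹ (legFactor i) (vertexFactor (U : MvPowerSeries (Fin d) ℝ)) n E = 0 := by
  rw [connCoeff_eq_sum_classes (by simpa using hA.isHermitian.inv) hU]
  refine Finset.sum_eq_zero fun c hc => ?_
  obtain ⟨h1, h2⟩ := Graph.mem_classes.1 hc
  rw [labelSum_eq_zero_of_lt A U i c.rep (by rwa [h1, h2]), mul_zero]

/-- The correlator of a polynomial potential as a sum over the numbers of edges of graphs. -/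
lemma coeff_correlator_hbar (hA : A.PosDef) {U : MvPolynomial (Fin d) ℝ}
    (hU : NoLowTerms (U : MvPowerSeries (Fin d) ℝ)) (i : Fin m → Fin d) (e : Fin 1 →₀ ℕ) :
    MvPowerSeries.coeff e (correlator A (hbarPotential U) fun j => MvPolynomial.X (i j)) =
      ∑ E ∈ Finset.range (m + e 0 * U.totalDegree + 1),
        connCoeff A⁻¹ (legFactor i) (vertexFactor (U : MvPowerSeries (Fin d) ℝ)) (e 0) E := by
  -- The range contains every `E` with `2E ≤ m + n * U.totalDegree`, and `connCoeff` vanishes for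
  -- all others.
  set S : MvPowerSeries (Fin 1) ℝ := fun e =>
    ∑ E ∈ Finset.range (m + e 0 * U.totalDegree + 1),
      connCoeff A⁻¹ (legFactor i) (vertexFactor (U : MvPowerSeries (Fin d) ℝ)) (e 0) E
  rw [correlator_eq_of_mul_eq hA (constantCoeff_hbarPotential U) _ S]
  · rfl
  ext e
  rw [MvPowerSeries.coeff_mul]
  -- Both sides are sums over `E` of the same series: the left by Cauchy products, the right by the
  -- factorization of the sum over all graphs.
  refine HasSum.unique (hasSum_sum fun p _ => hasSum_sum_antidiagonal
    (f := fun E => connCoeff A⁻¹ (legFactor i) (vertexFactor (U : MvPowerSeries (Fin d) ℝ))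
      (p.1 0) E) (a := MvPowerSeries.coeff p.1 S) ?_ (hasSum_coeff_partition_hbar hA U p.2)) ?_
  · change HasSum _ (∑ E ∈ Finset.range (m + p.1 0 * U.totalDegree + 1), _)
    refine hasSum_sum_of_ne_finset_zero fun E hE => ?_
    refine connCoeff_eq_zero_of_totalDegree_lt hA hU i ?_
    rw [Finset.mem_range, not_lt] at hE
    omega
  · convert! hasSum_coeff_perturbedInt_hbar hA U i e using 2 with E
    rw [sum_antidiagonal_fin_one e fun a b => ∑ y ∈ Finset.HasAntidiagonal.antidiagonal E,
      connCoeff A⁻¹ (legFactor i) (vertexFactor (U : MvPowerSeries (Fin d) ℝ)) a y.1 *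
        (gaussInt A 1 * vacCoeff A⁻¹ (vertexFactor (U : MvPowerSeries (Fin d) ℝ)) b y.2)]
    simp only [Finset.mul_sum]
    exact Finset.sum_congr rfl fun x _ => Finset.sum_congr rfl fun y _ => by ring

/-- Correlators of a polynomial potential as sums over graphs. -/
theorem hasSum_correlator_hbar (hA : A.PosDef) {U : MvPolynomial (Fin d) ℝ}
    (hU : NoLowTerms (U : MvPowerSeries (Fin d) ℝ)) (i : Fin m → Fin d) :
    HasSum (fun c : Graph.NonVacuumClass m =>
        (MvPowerSeries.X 0 : MvPowerSeries (Fin 1) ℝ) ^ c.rep.numInt * MvPowerSeries.C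
          ((1 / (c.rep.autCard : ℝ)) * labelSum A (U : MvPowerSeries (Fin d) ℝ) i c.rep))
      (correlator A (hbarPotential U) fun j => MvPolynomial.X (i j)) := by
  classical
  rw [MvPowerSeries.WithPiTopology.hasSum_iff_hasSum_coeff]
  intro e
  rw [coeff_correlator_hbar hA hU]
  simp only [connCoeff_eq_sum_classes (by simpa using hA.isHermitian.inv : (A⁻¹).IsSymm) hU]
  have hdisj : (↑(Finset.range (m + e 0 * U.totalDegree + 1)) : Set ℕ).PairwiseDisjoint
      fun E => Graph.classes m (e 0) E := by
    intro E _ E' _ hne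
    refine Finset.disjoint_left.2 fun c hc hc' => hne ?_
    rw [← (Graph.mem_classes.1 hc).2, (Graph.mem_classes.1 hc').2]
  have hcoeff : ∀ c : Graph.NonVacuumClass m, MvPowerSeries.coeff e
      ((MvPowerSeries.X 0 : MvPowerSeries (Fin 1) ℝ) ^ c.rep.numInt * MvPowerSeries.C
          ((1 / (c.rep.autCard : ℝ)) * labelSum A (U : MvPowerSeries (Fin d) ℝ) i c.rep)) =
      if c.rep.numInt = e 0 then
        (1 / (c.rep.autCard : ℝ)) * labelSum A (U : MvPowerSeries (Fin d) ℝ) i c.rep else 0 := by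
    intro c
    rw [MvPowerSeries.coeff_mul_C, MvPowerSeries.coeff_X_pow, ite_mul, one_mul, zero_mul]
    exact if_congr ((eq_single_fin_one_iff e _).trans eq_comm) rfl rfl
  simp only [hcoeff]
  rw [← Finset.sum_biUnion hdisj, ← Finset.sum_congr rfl fun c hc => if_pos (by
    obtain ⟨E, -, hE⟩ := Finset.mem_biUnion.1 hc
    exact (Graph.mem_classes.1 hE).1)]
  refine hasSum_sum_of_ne_finset_zero fun c hc => ?_
  split_ifs with h
  · rw [labelSum_eq_zero_of_lt, mul_zero]
    by_contra hlt
    refine hc (Finset.mem_biUnion.2 ⟨c.rep.numEdges, ?_, Graph.mem_classes.2 ⟨h, rfl⟩⟩)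
    rw [Finset.mem_range, ← h]
    omega
  · rfl

end Polynomial

/-! ### Formal potentials with degrees recorded by `t` -/

section Scaled

variable {d m : ℕ} {A : Matrix (Fin d) (Fin d) ℝ}

/-- The homogeneous component of degree `N` of a power series, as a polynomial. -/
def homPart (N : ℕ) (U : MvPowerSeries (Fin d) ℝ) : MvPolynomial (Fin d) ℝ :=
  MvPolynomial.homogeneousComponent N (MvPowerSeries.truncTotal (N + 1) U)

lemma coeff_homPart (N : ℕ) (U : MvPowerSeries (Fin d) ℝ) (s : Fin d →₀ ℕ) :
    MvPolynomial.coeff s (homPart N U) = if s.degree = N then MvPowerSeries.coeff s U else 0 := by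
  rw [homPart, MvPolynomial.coeff_homogeneousComponent]
  split_ifs with h
  · exact MvPowerSeries.coeff_truncTotal U (by omega)
  · rfl

lemma homPart_one (N : ℕ) : homPart N (1 : MvPowerSeries (Fin d) ℝ) = if N = 0 then 1 else 0 := by
  classical
  ext s
  rw [coeff_homPart, MvPowerSeries.coeff_one]
  by_cases hs : s = 0
  · subst hs
    by_cases hN : N = 0
    · simp [hN]
    · simp [hN, Ne.symm hN]
  · rw [if_neg hs, ite_self]
    split_ifs
    · rw [MvPolynomial.coeff_one, if_neg (Ne.symm hs)]
    · simp

lemma homPart_mul (N : ℕ) (P Q : MvPowerSeries (Fin d) ℝ) :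
    homPart N (P * Q) =
      ∑ y ∈ Finset.HasAntidiagonal.antidiagonal N, homPart y.1 P * homPart y.2 Q := by
  classical
  ext s
  rw [coeff_homPart, MvPolynomial.coeff_sum]
  simp only [MvPolynomial.coeff_mul, coeff_homPart]
  rw [Finset.sum_comm, MvPowerSeries.coeff_mul]
  split_ifs with h
  · refine Finset.sum_congr rfl fun x hx => ?_
    rw [Finset.HasAntidiagonal.mem_antidiagonal] at hx
    rw [Finset.sum_eq_single (x.1.degree, x.2.degree)]
    · simp
    · rintro ⟨a, b⟩ - hne
      by_cases h1 : x.1.degree = a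
      · rw [if_neg (show ¬ x.2.degree = b from fun h2 => hne (by rw [h1, h2])), mul_zero]
      · rw [if_neg h1, zero_mul]
    · intro hn
      refine absurd ?_ hn
      rw [Finset.HasAntidiagonal.mem_antidiagonal, ← h, ← hx, map_add]
  · symm
    refine Finset.sum_eq_zero fun x hx => Finset.sum_eq_zero fun y hy => ?_
    have hx' := Finset.HasAntidiagonal.mem_antidiagonal.1 hx
    rw [Finset.HasAntidiagonal.mem_antidiagonal] at hy
    by_cases h1 : x.1.degree = y.1
    · rw [if_neg (show ¬ x.2.degree = y.2 from fun h2 => h (by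
        rw [← hx', map_add, h1, h2, hy])), mul_zero]
    · rw [if_neg h1, zero_mul]

/-- Homogeneous components of products convolve (`homPart_mul`), and so do the exponents of `t`;
each factor contributes exactly one `ħ`. -/
lemma coeff_hbarScaledPotential_pow (U : MvPowerSeries (Fin d) ℝ) (n : ℕ) (e : Fin 2 →₀ ℕ) :
    MvPowerSeries.coeff e (hbarScaledPotential U ^ n) =
      if n = e 0 then homPart (e 1) (U ^ n) else 0 := by
  classical
  induction n generalizing e with
  | zero =>
    rw [pow_zero, pow_zero, MvPowerSeries.coeff_one, homPart_one, ← ite_and]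
    refine if_congr ⟨fun h => by simp [h], fun h => pairExp_ext ?_ ?_⟩ rfl rfl
    · simp [← h.1]
    · simp [h.2]
  | succ n ih =>
    rw [pow_succ, MvPowerSeries.coeff_mul]
    have h1 : ∀ p : (Fin 2 →₀ ℕ) × (Fin 2 →₀ ℕ),
        MvPowerSeries.coeff p.1 (hbarScaledPotential U ^ n) *
          MvPowerSeries.coeff p.2 (hbarScaledPotential U) =
        (if n = p.1 0 then homPart (p.1 1) (U ^ n) else 0) *
          (if p.2 0 = 1 then homPart (p.2 1) U else 0) := fun p => by rw [ih]; rfl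
    simp only [h1]
    rw [sum_antidiagonal_fin_two e fun a b c f => (if n = a then homPart c (U ^ n) else 0) *
      (if b = 1 then homPart f U else 0)]
    split_ifs with h
    · rw [Finset.sum_eq_single (n, 1)]
      · rw [pow_succ, homPart_mul]
        simp
      · rintro ⟨a, b⟩ - hne
        refine Finset.sum_eq_zero fun y _ => ?_
        by_cases h2 : n = a
        · rw [if_neg (show ¬ b = 1 from fun h3 => hne (by rw [h2, h3])), mul_zero]
        · rw [if_neg h2, zero_mul]
      · intro hn
        exact absurd (Finset.HasAntidiagonal.mem_antidiagonal.2 h) hn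
    · refine Finset.sum_eq_zero fun x hx => Finset.sum_eq_zero fun y _ => ?_
      rw [Finset.HasAntidiagonal.mem_antidiagonal] at hx
      by_cases h2 : n = x.1
      · rw [if_neg (show ¬ x.2 = 1 from fun h3 => h (by rw [← hx, ← h2, h3])), mul_zero]
      · rw [if_neg h2, zero_mul]

lemma constantCoeff_hbarScaledPotential (U : MvPowerSeries (Fin d) ℝ) :
    MvPowerSeries.constantCoeff (hbarScaledPotential U) = 0 := by
  rw [← MvPowerSeries.coeff_zero_eq_constantCoeff_apply, ← pow_one (hbarScaledPotential U),
    coeff_hbarScaledPotential_pow]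
  simp

/-- The `m` linear factors shift the degree by `m`, so only `2E = N + m` will contribute. -/
lemma vertexFactor_homPart_mul_prod_X (i : Fin m → Fin d) (N : ℕ) (Q : MvPowerSeries (Fin d) ℝ)
    (s : Multiset (Fin d)) :
    vertexFactor ((homPart N Q * ∏ j, MvPolynomial.X (i j) : MvPolynomial (Fin d) ℝ) :
      MvPowerSeries (Fin d) ℝ) s =
      if s.card = N + m then vertexFactor (Q * ∏ j, MvPowerSeries.X (i j)) s else 0 := by
  have hmon : ∏ j, (MvPowerSeries.X (i j) : MvPowerSeries (Fin d) ℝ) =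
      MvPowerSeries.monomial (∑ j, Finsupp.single (i j) 1) 1 := by
    rw [← coe_prod_X, ← MvPolynomial.coe_monomial, MvPolynomial.monomial_sum_one]
    rfl
  have hdeg : (∑ j, Finsupp.single (i j) 1 : Fin d →₀ ℕ).degree = m := by
    simp [map_sum]
  rw [MvPolynomial.coe_mul, coe_prod_X, hmon, vertexFactor, vertexFactor,
    MvPowerSeries.coeff_mul_monomial, MvPowerSeries.coeff_mul_monomial, MvPolynomial.coeff_coe,
    coeff_homPart, ← degree_toFinsupp]
  split_ifs with h1 h2 h3 h3
  · rfl
  · refine absurd ?_ h3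
    rw [← hdeg, ← h2, ← map_add, tsub_add_cancel_of_le h1]
  · refine absurd ?_ h2
    have h4 := congrArg Finsupp.degree (tsub_add_cancel_of_le h1)
    rw [map_add, hdeg] at h4
    omega
  all_goals simp

lemma hasSum_coeff_perturbedInt_hbarScaled (hA : A.PosDef) (U : MvPowerSeries (Fin d) ℝ)
    (i : Fin m → Fin d) (e : Fin 2 →₀ ℕ) :
    HasSum (fun E : ℕ => if 2 * E = e 1 + m then
      gaussInt A 1 * ∑ x ∈ Finset.HasAntidiagonal.antidiagonal (e 0),
        ∑ y ∈ Finset.HasAntidiagonal.antidiagonal E,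
          connCoeff A⁻¹ (legFactor i) (vertexFactor U) x.1 y.1 *
            vacCoeff A⁻¹ (vertexFactor U) x.2 y.2 else 0)
      (MvPowerSeries.coeff e
        (perturbedInt A (hbarScaledPotential U) (∏ j, MvPolynomial.X (i j)))) := by
  rw [coeff_perturbedInt (constantCoeff_hbarScaledPotential U) A _ e (e 0) fun k hk => by
    rw [coeff_hbarScaledPotential_pow, if_neg hk], coeff_hbarScaledPotential_pow, if_pos rfl]
  have h := (hasSum_gaussInt_graphWeight_of_degree hA
    (homPart (e 1) (U ^ e 0) * ∏ j, MvPolynomial.X (i j)) (integrandFactor i U (e 0)) (e 1 + m)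
    fun s => by rw [prod_integrandFactor, vertexFactor_homPart_mul_prod_X]).mul_left
      ((e 0)! : ℝ)⁻¹
  convert! h using 2 with E
  split_ifs
  · rw [vertexFactor_integrandFactor, ← sum_graphWeight_eq, mul_inv]
    ring
  · ring

lemma hasSum_coeff_partition_hbarScaled (hA : A.PosDef) (U : MvPowerSeries (Fin d) ℝ)
    (e : Fin 2 →₀ ℕ) :
    HasSum (fun E : ℕ => if 2 * E = e 1 then
      gaussInt A 1 * vacCoeff A⁻¹ (vertexFactor U) (e 0) E else 0)
      (MvPowerSeries.coeff e (perturbedInt A (hbarScaledPotential U) 1)) := by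
  rw [coeff_perturbedInt (constantCoeff_hbarScaledPotential U) A _ e (e 0) fun k hk => by
    rw [coeff_hbarScaledPotential_pow, if_neg hk], coeff_hbarScaledPotential_pow, if_pos rfl]
  have h := (hasSum_gaussInt_graphWeight_of_degree hA
    (homPart (e 1) (U ^ e 0) * 1) (fun _ : Fin (e 0) => U) (e 1)
    fun s => by
      have := vertexFactor_homPart_mul_prod_X (Fin.elim0 : Fin 0 → Fin d) (e 1) (U ^ e 0) s
      simpa using this).mul_left ((e 0)! : ℝ)⁻¹
  convert! h using 2 with E
  split_ifs
  · rw [vacCoeff, vacSum, mul_inv]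
    ring
  · ring

/-- The correlator of a formal potential as a sum over the numbers of edges of graphs. -/
lemma coeff_correlator_hbarScaled (hA : A.PosDef) (U : MvPowerSeries (Fin d) ℝ)
    (i : Fin m → Fin d) (e : Fin 2 →₀ ℕ) :
    MvPowerSeries.coeff e (correlator A (hbarScaledPotential U) fun j => MvPolynomial.X (i j)) =
      ∑ E ∈ Finset.range (e 1 + m + 1), if 2 * E = e 1 + m then
        connCoeff A⁻¹ (legFactor i) (vertexFactor U) (e 0) E else 0 := by
  -- At most one `E` survives, namely half of `e 1 + m`, and none when this number is odd.
  set S : MvPowerSeries (Fin 2) ℝ := fun e =>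
    ∑ E ∈ Finset.range (e 1 + m + 1), if 2 * E = e 1 + m then
      connCoeff A⁻¹ (legFactor i) (vertexFactor U) (e 0) E else 0
  rw [correlator_eq_of_mul_eq hA (constantCoeff_hbarScaledPotential U) _ S]
  · rfl
  ext e
  rw [MvPowerSeries.coeff_mul]
  refine HasSum.unique (hasSum_sum fun p _ => hasSum_sum_antidiagonal
    (f := fun E => if 2 * E = p.1 1 + m then
      connCoeff A⁻¹ (legFactor i) (vertexFactor U) (p.1 0) E else 0)
    (a := MvPowerSeries.coeff p.1 S) ?_ (hasSum_coeff_partition_hbarScaled hA U p.2)) ?_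
  · change HasSum _ (∑ E ∈ Finset.range (p.1 1 + m + 1), _)
    refine hasSum_sum_of_ne_finset_zero fun E hE => if_neg fun h => ?_
    rw [Finset.mem_range, not_lt] at hE
    omega
  · convert! hasSum_coeff_perturbedInt_hbarScaled hA U i e using 2 with E
    rw [sum_antidiagonal_fin_two e fun a b M N => ∑ y ∈ Finset.HasAntidiagonal.antidiagonal E,
      (if 2 * y.1 = M + m then connCoeff A⁻¹ (legFactor i) (vertexFactor U) a y.1 else 0) *
        (if 2 * y.2 = N then gaussInt A 1 * vacCoeff A⁻¹ (vertexFactor U) b y.2 else 0)]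
    have key : ∀ (x y : ℕ × ℕ), y ∈ Finset.HasAntidiagonal.antidiagonal E →
        ∑ u ∈ Finset.HasAntidiagonal.antidiagonal (e 1),
          (if 2 * y.1 = u.1 + m then connCoeff A⁻¹ (legFactor i) (vertexFactor U) x.1 y.1 else 0) *
            (if 2 * y.2 = u.2 then gaussInt A 1 * vacCoeff A⁻¹ (vertexFactor U) x.2 y.2 else 0) =
        if 2 * E = e 1 + m then connCoeff A⁻¹ (legFactor i) (vertexFactor U) x.1 y.1 *
          (gaussInt A 1 * vacCoeff A⁻¹ (vertexFactor U) x.2 y.2) else 0 := by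
      intro x y hy
      rw [Finset.HasAntidiagonal.mem_antidiagonal] at hy
      -- Given the edge numbers `y`, the exponents of `t` are forced to be `2 * y.1 - m` and `2 *
      -- y.2`. The subtraction would truncate when `2 * y.1 < m`, but then too few ends exist for
      -- the legs and the term is zero.
      by_cases hlt : 2 * y.1 < m
      · rw [connCoeff_eq_zero_of_lt _ _ _ hlt]
        simp
      split_ifs with h
      · rw [Finset.sum_eq_single (2 * y.1 - m, 2 * y.2)]
        · rw [if_pos (by dsimp only; omega), if_pos rfl]
        · rintro ⟨M, N⟩ - hne
          by_cases h1 : 2 * y.1 = M + m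
          · rw [if_neg (c := 2 * y.2 = N) (fun h2 => hne (by rw [h1, h2, Nat.add_sub_cancel])),
              mul_zero]
          · rw [if_neg h1, zero_mul]
        · intro hn
          refine absurd (Finset.HasAntidiagonal.mem_antidiagonal.2 ?_) hn
          dsimp only
          omega
      · refine Finset.sum_eq_zero fun u hu => ?_
        rw [Finset.HasAntidiagonal.mem_antidiagonal] at hu
        by_cases h1 : 2 * y.1 = u.1 + m
        · rw [if_neg (c := 2 * y.2 = u.2) (by omega), mul_zero]
        · rw [if_neg h1, zero_mul]
    rw [Finset.sum_congr rfl fun x _ => Finset.sum_comm.trans (Finset.sum_congr rfl (key x))]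
    split_ifs
    · simp only [Finset.mul_sum]
      exact Finset.sum_congr rfl fun x _ => Finset.sum_congr rfl fun y _ => by ring
    · simp

/-- Correlators of a formal potential, with degrees recorded by a second parameter, as sums over
graphs. -/
theorem hasSum_correlator_hbarScaled (hA : A.PosDef) {U : MvPowerSeries (Fin d) ℝ}
    (hU : NoLowTerms U) (i : Fin m → Fin d) :
    HasSum (fun c : Graph.NonVacuumClass m =>
        (MvPowerSeries.X 0 : MvPowerSeries (Fin 2) ℝ) ^ c.rep.numInt *
          MvPowerSeries.X 1 ^ c.rep.totalValence *
          MvPowerSeries.C ((1 / (c.rep.autCard : ℝ)) * labelSum A U i c.rep))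
      (correlator A (hbarScaledPotential U) fun j => MvPolynomial.X (i j)) := by
  classical
  rw [MvPowerSeries.WithPiTopology.hasSum_iff_hasSum_coeff]
  intro e
  rw [coeff_correlator_hbarScaled hA]
  simp only [connCoeff_eq_sum_classes (by simpa using hA.isHermitian.inv : (A⁻¹).IsSymm) hU]
  have hdisj : (↑((Finset.range (e 1 + m + 1)).filter fun E => 2 * E = e 1 + m) :
      Set ℕ).PairwiseDisjoint fun E => Graph.classes m (e 0) E := by
    intro E _ E' _ hne
    refine Finset.disjoint_left.2 fun c hc hc' => hne ?_
    rw [← (Graph.mem_classes.1 hc).2, (Graph.mem_classes.1 hc').2]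
  have hcoeff : ∀ c : Graph.NonVacuumClass m, MvPowerSeries.coeff e
      ((MvPowerSeries.X 0 : MvPowerSeries (Fin 2) ℝ) ^ c.rep.numInt *
          MvPowerSeries.X 1 ^ c.rep.totalValence *
          MvPowerSeries.C ((1 / (c.rep.autCard : ℝ)) * labelSum A U i c.rep)) =
      if c.rep.numInt = e 0 ∧ c.rep.totalValence = e 1 then
        (1 / (c.rep.autCard : ℝ)) * labelSum A U i c.rep else 0 := by
    intro c
    rw [MvPowerSeries.coeff_mul_C, MvPowerSeries.X_pow_eq, MvPowerSeries.X_pow_eq,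
      MvPowerSeries.monomial_mul_monomial, MvPowerSeries.coeff_monomial, one_mul, ite_mul, one_mul,
      zero_mul]
    refine if_congr ⟨fun h => by simp [h], fun h => ?_⟩ rfl rfl
    exact pairExp_ext (by simp [h.1]) (by simp [h.2])
  simp only [hcoeff]
  -- By `totalValence_add`, the conditions `totalValence = e 1` and `2 * numEdges = e 1 + m` agree,
  -- so the classes counted by edges are those with the right power of `t`.
  rw [← Finset.sum_filter, ← Finset.sum_biUnion hdisj, ← Finset.sum_congr rfl fun c hc => if_pos (by
    obtain ⟨E, hE', hE⟩ := Finset.mem_biUnion.1 hc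
    have h1 := Graph.mem_classes.1 hE
    have h2 := c.rep.totalValence_add
    have h3 := (Finset.mem_filter.1 hE').2
    exact (⟨h1.1, by omega⟩ : c.rep.numInt = e 0 ∧ c.rep.totalValence = e 1))]
  refine hasSum_sum_of_ne_finset_zero fun c hc => if_neg fun h => hc ?_
  have h2 := c.rep.totalValence_add
  refine Finset.mem_biUnion.2 ⟨c.rep.numEdges, ?_, Graph.mem_classes.2 ⟨h.1, rfl⟩⟩
  rw [Finset.mem_filter, Finset.mem_range]
  omega

end Scaled

end Feynman

end

theorem mainTheorem4 {d m : ℕ} (hm : Even m) (A : Matrix (Fin d) (Fin d) ℝ) (hA : A.PosDef)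
    (i : Fin m → Fin d) :
    (∀ U : MvPolynomial (Fin d) ℝ, Feynman.NoLowTerms (U : MvPowerSeries (Fin d) ℝ) →
      HasSum
        (fun c : Feynman.Graph.NonVacuumClass m =>
          (MvPowerSeries.X 0 : MvPowerSeries (Fin 1) ℝ) ^ c.rep.numInt *
            MvPowerSeries.C
              ((1 / (c.rep.autCard : ℝ)) * Feynman.labelSum A (U : MvPowerSeries (Fin d) ℝ) i c.rep))
        (Feynman.correlator A (Feynman.hbarPotential U) fun j => MvPolynomial.X (i j))) ∧
    (∀ U : MvPowerSeries (Fin d) ℝ, Feynman.NoLowTerms U →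
      HasSum
        (fun c : Feynman.Graph.NonVacuumClass m =>
          (MvPowerSeries.X 0 : MvPowerSeries (Fin 2) ℝ) ^ c.rep.numInt *
            MvPowerSeries.X 1 ^ c.rep.totalValence *
            MvPowerSeries.C ((1 / (c.rep.autCard : ℝ)) * Feynman.labelSum A U i c.rep))
        (Feynman.correlator A (Feynman.hbarScaledPotential U) fun j => MvPolynomial.X (i j))) :=
  ⟨fun _ hU => Feynman.hasSum_correlator_hbar hA hU i,
    fun _ hU => Feynman.hasSum_correlator_hbarScaled hA hU i⟩
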